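/- All graphs are finite and simple. For a graph $G$, a \emph{strong clique} of $G$ is a set $S$ of edges of $G$ such that any two edges in $S$ are at distance at most $2$ in the line graph of $G$; that is, any two distinct edges of $S$ share an endpoint or are joined by an edge of $G$ (which need not belong to $S$). The \emph{strong clique number} $\mathrm{SC}(G)$ is the maximum size of a strong clique of $G$, and $\Delta(G)$ denotes the maximum degree of $G$. A graph is $C_{2k}$-free if it contains no cycle of length $2k$ as a (not necessarily induced) subgraph. Theorem. Let $k\ge 3$ be an integer. If $G$ is a $C_{2k}$-free graph with $\Delta(G)\ge 1$, then $$\mathrm{SC}(G)\le (2k-1)\,\Delta(G)+(2k-1)^2.$$ -/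

import Mathlib

namespace SimpleGraph

variable {V : Type*}

/-- A set `S` of edges of `G` is a strong clique of `G` if any two edges of `S` are at distance at
most `2` in the line graph of `G`, i.e. they are equal, share an endpoint, or some edge of `G`
(not necessarily in `S`) joins an endpoint of one to an endpoint of the other. The extended
distance is used, so edges in different components are at infinite distance. -/
def IsStrongClique (G : SimpleGraph V) (S : Set G.edgeSet) : Prop :=
  ∀ e ∈ S, ∀ f ∈ S, G.lineGraph.edist e f ≤ 2

/-- The strong clique number `SC(G)` of a finite graph `G`: the maximum size of a strong clique. -/
noncomputable def strongCliqueNum (G : SimpleGraph V) : ℕ :=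
  sSup {n | ∃ S : Finset G.edgeSet, G.IsStrongClique (S : Set G.edgeSet) ∧ S.card = n}

end SimpleGraph

/-!
Let `S` be a strong clique of a `C_{2k}`-free graph `G` and `M` a maximum matching contained in `S`.

*Few edges around a maximum matching.* If `M` has `ν` edges, then `|S| ≤ ν Δ + ν ^ 2`
(`SimpleGraph.card_le_of_maximum_matching`): by maximality each matching edge can be written
`s(a, b)` so that `b` has at most one `S`-neighbour outside of `M`. At most `ν Δ` edges of `S` meet
one of the heads `a`, and each of the others joins a tail `b` to one of the `ν - 1` other tails
or to its only outside neighbour. So it suffices that `ν ≤ 2k - 1`, i.e. that a strong clique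
containing a matching of `2k` edges forces a cycle `C_{2k}`.

*Cycles from a matching.* Between any two edges `x`, `y` of the matching fix a connecting edge, and
let `ε x y` be the end of `x` that it uses. A cyclic sequence of distinct matching edges then
describes a cycle of `G`, which passes through `x` by one vertex or, if the connections to the
predecessor and to the successor of `x` use different ends ("`x` is a turn"), by both. Its length is
the `weight` of the sequence, the number of terms plus the number of turns. The claim is that some
cyclic sequence has weight exactly `2k` (`exists_weight_eq_two_mul`), for every choice of `ε` on
`2k ≥ 6` matching edges.

The only modification used is to take an unvisited matching edge `e` and to put it in place of the
terms strictly between two terms of the sequence; this changes the weight by a `gain` that depends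
only on how `e` is attached to these two terms and on the turns nearby (`gain`,
`IsCyclicSeq.weight_splice`).

* A sequence of greatest weight subject to weight at most `2k` has weight at least `2k - 2`
  (`exists_weight_near`).
* If there is a sequence of weight `2k - 2`, take one with the most terms. If no sequence had weight
  `2k`, no replacement would gain `2`, no insertion would gain `0`, and no two compatible
  replacements would gain `2` together. This rules out turns when three edges are unvisited, because
  two of them are attached to a turn by the same end (`IsExtremalSeq.turn_eq_false`). So there are
  no turns and `2k - 2` terms, but then the two unvisited edges force a turn
  (`IsExtremalSeq.exists_turn`).
* If there is a sequence of weight `2k - 1` but none of weight `2k` or `2k - 2`, no replacement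
  changes the weight by `±1`. Looking at five consecutive terms one finds that all insertions of `e`
  have even gain. Summing over the sequence, its weight would be even
  (`IsCyclicSeq.even_weight_of_even_gain`), a contradiction.
-/

/-! ### Cyclic sequences of matching edges -/

section CyclicSequences

variable {ι : Type*}

/-- Whether the passage `p → x → q` uses both ends of the matching edge `x`. Here `ε x y` is the
end of `x` used by the edge that connects the matching edges `x` and `y`. -/
def bend (ε : ι → ι → Bool) (p x q : ι) : Bool := xor (ε x p) (ε x q)

/-- An `n`-periodic sequence, injective on a period: a cycle of length `n ≥ 3` in the complete
graph on `ι`. -/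
structure IsCyclicSeq (n : ℕ) (u : ℕ → ι) : Prop where
  three_le : 3 ≤ n
  periodic : ∀ j, u (j + n) = u j
  inj : ∀ i < n, ∀ j < n, u i = u j → i = j

/-- Whether a cyclic sequence uses both ends of its `j`-th matching edge. The predecessor of `j`
is written `j + n - 1` so that it makes sense for `j = 0`. -/
def turn (ε : ι → ι → Bool) (n : ℕ) (u : ℕ → ι) (j : ℕ) : Bool :=
  bend ε (u (j + n - 1)) (u j) (u (j + 1))

/-- Whether both ends of the `j`-th matching edge are used when the sequence leaves towards `e`. -/
def off (ε : ι → ι → Bool) (n : ℕ) (u : ℕ → ι) (e : ι) (j : ℕ) : Bool :=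
  bend ε (u (j + n - 1)) (u j) e

/-- The length of the cycle of the underlying graph that a cyclic sequence describes. -/
def weight (ε : ι → ι → Bool) (n : ℕ) (u : ℕ → ι) : ℤ :=
  ∑ j ∈ Finset.range n, (1 + (turn ε n u j).toInt)

/-- The change of weight when the part of the sequence strictly between the positions `i` and
`i + d` is replaced by the single new matching edge `e`. -/
def gain (ε : ι → ι → Bool) (n : ℕ) (u : ℕ → ι) (e : ι) (i d : ℕ) : ℤ :=
  1 + (xor (ε e (u i)) (ε e (u (i + d)))).toInt
    + ((off ε n u e i).toInt - (turn ε n u i).toInt)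
    + ((xor (off ε n u e (i + d)) (turn ε n u (i + d))).toInt - (turn ε n u (i + d)).toInt)
    - ∑ j ∈ Finset.range (d - 1), (1 + (turn ε n u (i + 1 + j)).toInt)

/-- The `(m + 2)`-periodic sequence that runs through `u s, …, u (s + m)` and then through `e`. -/
def spliceSeq (u : ℕ → ι) (s m : ℕ) (e : ι) (j : ℕ) : ι :=
  if j % (m + 2) = m + 1 then e else u (s + j % (m + 2))

namespace IsCyclicSeq

variable {ε : ι → ι → Bool} {n : ℕ} {u : ℕ → ι}

theorem apply_mod (h : IsCyclicSeq n u) (j : ℕ) : u (j % n) = u j :=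
  (show Function.Periodic u n from h.periodic).map_mod_nat j

theorem eq_iff (h : IsCyclicSeq n u) {i j : ℕ} : u i = u j ↔ i % n = j % n := by
  have hn : 0 < n := by have := h.three_le; omega
  constructor
  · intro hij
    refine h.inj _ (Nat.mod_lt _ hn) _ (Nat.mod_lt _ hn) ?_
    rw [h.apply_mod, h.apply_mod, hij]
  · intro hij
    rw [← h.apply_mod i, hij, h.apply_mod]

theorem turn_add (h : IsCyclicSeq n u) (j : ℕ) : turn ε n u (j + n) = turn ε n u j := by
  have hn := h.three_le
  have h1 : u (j + n + n - 1) = u (j + n - 1) := by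
    rw [show j + n + n - 1 = (j + n - 1) + n by omega, h.periodic]
  have h2 : u (j + n + 1) = u (j + 1) := by
    rw [show j + n + 1 = (j + 1) + n by omega, h.periodic]
  simp only [turn, h1, h2, h.periodic]

theorem off_add (h : IsCyclicSeq n u) (e : ι) (j : ℕ) :
    off ε n u e (j + n) = off ε n u e j := by
  have hn := h.three_le
  have h1 : u (j + n + n - 1) = u (j + n - 1) := by
    rw [show j + n + n - 1 = (j + n - 1) + n by omega, h.periodic]
  simp only [off, h1, h.periodic]

theorem gain_add (h : IsCyclicSeq n u) (e : ι) (i d : ℕ) :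
    gain ε n u e (i + n) d = gain ε n u e i d := by
  have h3 : ∀ j, turn ε n u (i + n + 1 + j) = turn ε n u (i + 1 + j) := fun j => by
    rw [show i + n + 1 + j = (i + 1 + j) + n by omega, h.turn_add]
  simp only [gain, h.periodic, h.off_add, h.turn_add, h3,
    show i + n + d = (i + d) + n by omega]

end IsCyclicSeq

/-- A sum over a period does not depend on where the period starts. -/
theorem sum_range_shift_of_periodic {M : Type*} [AddCommMonoid M] {f : ℕ → M} {n : ℕ}
    (hf : ∀ j, f (j + n) = f j) (s : ℕ) :
    ∑ j ∈ Finset.range n, f (s + j) = ∑ j ∈ Finset.range n, f j := by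
  induction s with
  | zero => simp
  | succ s ih =>
    rw [← ih]
    cases n with
    | zero => simp
    | succ n =>
      rw [Finset.sum_range_succ, Finset.sum_range_succ']
      congr 1
      · exact Finset.sum_congr rfl fun j _ => by congr 1; omega
      · have := hf s
        rw [show s + 1 + n = s + (n + 1) by omega, this, add_zero]

namespace IsCyclicSeq

variable {ε : ι → ι → Bool} {n : ℕ} {u : ℕ → ι}

theorem weight_eq_sum_shift (h : IsCyclicSeq n u) (s : ℕ) :
    weight ε n u = ∑ j ∈ Finset.range n, (1 + (turn ε n u (s + j)).toInt) :=
  (sum_range_shift_of_periodic (f := fun j => 1 + (turn ε n u j).toInt)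
    (fun j => by simp only [h.turn_add]) s).symm

/-- A cyclic sequence may be started anywhere. -/
theorem shift (h : IsCyclicSeq n u) (s : ℕ) : IsCyclicSeq n fun j => u (s + j) where
  three_le := h.three_le
  periodic j := by rw [← add_assoc, h.periodic]
  inj i hi j hj hij := by
    have : i % n = j % n := Nat.ModEq.add_left_cancel' s (h.eq_iff.1 hij)
    rwa [Nat.mod_eq_of_lt hi, Nat.mod_eq_of_lt hj] at this

theorem turn_shift (h : IsCyclicSeq n u) (s j : ℕ) :
    turn ε n (fun j => u (s + j)) j = turn ε n u (s + j) := by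
  have hn := h.three_le
  simp only [turn, show s + (j + n - 1) = s + j + n - 1 by omega, ← add_assoc]

theorem weight_shift (h : IsCyclicSeq n u) (s : ℕ) :
    weight ε n (fun j => u (s + j)) = weight ε n u := by
  rw [h.weight_eq_sum_shift s, weight]
  simp only [h.turn_shift]

theorem le_weight : (n : ℤ) ≤ weight ε n u := by
  have : ∑ _j ∈ Finset.range n, (1 : ℤ) ≤ weight ε n u :=
    Finset.sum_le_sum fun j _ => by cases turn ε n u j <;> simp
  simpa using this

theorem weight_le : weight ε n u ≤ 2 * n := by
  have : weight ε n u ≤ ∑ _j ∈ Finset.range n, (2 : ℤ) :=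
    Finset.sum_le_sum fun j _ => by cases turn ε n u j <;> simp
  simpa [mul_comm] using this

theorem splice (h : IsCyclicSeq n u) (s : ℕ) {m : ℕ} (hm : 1 ≤ m) (hmn : m + 1 ≤ n) {e : ι}
    (he : ∀ j, u j ≠ e) : IsCyclicSeq (m + 2) (spliceSeq u s m e) where
  three_le := by omega
  periodic j := by simp [spliceSeq]
  inj i hi j hj hij := by
    simp only [spliceSeq, Nat.mod_eq_of_lt hi, Nat.mod_eq_of_lt hj] at hij
    split_ifs at hij with h1 h2 h2
    · omega
    · exact absurd hij.symm (he _)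
    · exact absurd hij (he _)
    · have : i % n = j % n := Nat.ModEq.add_left_cancel' s (h.eq_iff.1 hij)
      rwa [Nat.mod_eq_of_lt (by omega), Nat.mod_eq_of_lt (by omega)] at this

theorem splice_apply_of_le {s m : ℕ} {e : ι} {j : ℕ} (hj : j ≤ m) :
    spliceSeq u s m e j = u (s + j) := by
  rw [spliceSeq, Nat.mod_eq_of_lt (by omega), if_neg (by omega)]

theorem splice_apply_last {s m : ℕ} {e : ι} : spliceSeq u s m e (m + 1) = e := by
  rw [spliceSeq, Nat.mod_eq_of_lt (by omega), if_pos rfl]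

theorem splice_apply_add {s m : ℕ} {e : ι} (j : ℕ) :
    spliceSeq u s m e (j + (m + 2)) = spliceSeq u s m e j := by
  simp [spliceSeq]

theorem weight_splice (h : IsCyclicSeq n u) (i : ℕ) {m d : ℕ} (hm : 1 ≤ m) (hd : 1 ≤ d)
    (hmd : m + d = n) (e : ι) :
    weight ε (m + 2) (spliceSeq u (i + d) m e) = weight ε n u + gain ε n u e i d := by
  obtain ⟨m, rfl⟩ : ∃ a, m = a + 1 := ⟨m - 1, by omega⟩
  obtain ⟨d, rfl⟩ : ∃ a, d = a + 1 := ⟨d - 1, by omega⟩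
  set w := spliceSeq u (i + (d + 1)) (m + 1) e with hw
  have hwj : ∀ j, j ≤ m + 1 → w j = u (i + (d + 1) + j) := fun j hj => splice_apply_of_le hj
  have hwe : w (m + 2) = e := splice_apply_last
  have hw0 : w (m + 3) = w 0 := by simpa using splice_apply_add (u := u) (s := i + (d + 1)) 0
  have hui : u (i + (d + 1) + (m + 1)) = u i := by
    rw [show i + (d + 1) + (m + 1) = i + n by omega, h.periodic]
  -- the four kinds of positions of the new sequence
  have t0 : turn ε (m + 1 + 2) w 0
      = xor (off ε n u e (i + (d + 1))) (turn ε n u (i + (d + 1))) := by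
    have e1 : w (0 + (m + 1 + 2) - 1) = e := by
      rw [show 0 + (m + 1 + 2) - 1 = m + 2 by omega, hwe]
    simp only [turn, off, bend]
    rw [e1, hwj 0 (by omega), hwj (0 + 1) (by omega), zero_add, add_zero]
    cases ε (u (i + (d + 1))) e <;> cases ε (u (i + (d + 1))) (u (i + (d + 1) + 1)) <;>
      cases ε (u (i + (d + 1))) (u (i + (d + 1) + n - 1)) <;> rfl
  have t1 : ∀ j < m, turn ε (m + 1 + 2) w (j + 1) = turn ε n u (i + (d + 1) + (j + 1)) := by
    intro j hj
    have e1 : w (j + 1 + (m + 1 + 2) - 1) = u (i + (d + 1) + (j + 1) + n - 1) := by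
      rw [show j + 1 + (m + 1 + 2) - 1 = j + (m + 1 + 2) by omega, hw, splice_apply_add,
        splice_apply_of_le (by omega),
        show i + (d + 1) + (j + 1) + n - 1 = i + (d + 1) + j + n by omega, h.periodic]
    rw [turn, turn, e1, hwj (j + 1) (by omega), hwj (j + 1 + 1) (by omega), ← add_assoc _ (j + 1) 1]
  have t2 : turn ε (m + 1 + 2) w (m + 1) = off ε n u e i := by
    have e1 : w (m + 1 + (m + 1 + 2) - 1) = u (i + n - 1) := by
      rw [show m + 1 + (m + 1 + 2) - 1 = m + (m + 1 + 2) by omega, hw, splice_apply_add,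
        splice_apply_of_le (by omega), show i + (d + 1) + m = i + n - 1 by omega]
    simp only [turn, off, e1, hwj (m + 1) (by omega), hui, hwe]
  have t3 : turn ε (m + 1 + 2) w (m + 2) = xor (ε e (u i)) (ε e (u (i + (d + 1)))) := by
    have e1 : w (m + 2 + (m + 1 + 2) - 1) = u i := by
      rw [show m + 2 + (m + 1 + 2) - 1 = m + 1 + (m + 1 + 2) by omega, hw, splice_apply_add,
        splice_apply_of_le (by omega), hui]
    simp only [turn, bend, e1, hwe, hw0, hwj 0 (by omega), add_zero]
  have hnew : weight ε (m + 1 + 2) w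
      = (1 + (xor (off ε n u e (i + (d + 1))) (turn ε n u (i + (d + 1)))).toInt)
        + ∑ j ∈ Finset.range m, (1 + (turn ε n u (i + (d + 1) + (j + 1))).toInt)
        + (1 + (off ε n u e i).toInt)
        + (1 + (xor (ε e (u i)) (ε e (u (i + (d + 1))))).toInt) := by
    rw [weight, Finset.sum_range_succ, Finset.sum_range_succ, Finset.sum_range_succ', t0, t2, t3,
      Finset.sum_congr rfl fun j hj => by rw [t1 j (Finset.mem_range.1 hj)]]
    ring
  have hold : weight ε n u
      = (1 + (turn ε n u (i + (d + 1))).toInt)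
        + ∑ j ∈ Finset.range m, (1 + (turn ε n u (i + (d + 1) + (j + 1))).toInt)
        + (1 + (turn ε n u i).toInt)
        + ∑ j ∈ Finset.range d, (1 + (turn ε n u (i + 1 + j)).toInt) := by
    rw [h.weight_eq_sum_shift (i + (d + 1)), show Finset.range n = Finset.range (m + 1 + 1 + d) by
      rw [← hmd]; congr 1; omega, Finset.sum_range_add, Finset.sum_range_succ,
      Finset.sum_range_succ', add_zero]
    have e1 : turn ε n u (i + (d + 1) + (m + 1)) = turn ε n u i := by
      rw [show i + (d + 1) + (m + 1) = i + n by omega, h.turn_add]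
    have e2 : ∀ j, turn ε n u (i + (d + 1) + (m + 1 + 1 + j)) = turn ε n u (i + 1 + j) := by
      intro j
      rw [show i + (d + 1) + (m + 1 + 1 + j) = (i + 1 + j) + n by omega, h.turn_add]
    simp only [e1, e2]
    ring
  rw [hnew, hold, gain, Nat.add_sub_cancel]
  ring

end IsCyclicSeq

end CyclicSequences

/-! ### One and two replacements -/

section CyclicSequences

variable {ι : Type*}

namespace IsCyclicSeq

variable {ε : ι → ι → Bool} {n : ℕ} {u : ℕ → ι}

theorem exists_weight_add_gain (h : IsCyclicSeq n u) {e : ι} (he : ∀ j, u j ≠ e) (i : ℕ) {d : ℕ}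
    (hd : 1 ≤ d) (hdn : d + 1 ≤ n) :
    ∃ u', IsCyclicSeq (n - d + 2) u' ∧ weight ε (n - d + 2) u' = weight ε n u + gain ε n u e i d :=
  ⟨_, h.splice (i + d) (by omega) (by omega) he, h.weight_splice i (by omega) hd (by omega) e⟩

/-- Inserting `f` between the positions `i` and `i + 1` does not influence the gain of a later
replacement by `e`, unless the two moves meet in a matching edge which they enter badly. -/
theorem gain_splice (h : IsCyclicSeq n u) {e f : ι} {i j d : ℕ} (hd : 1 ≤ d) (hjd : j + d + 1 ≤ n)
    (hfst : j = 0 → off ε n u f (i + 1) = false ∨ off ε n u e (i + 1) = turn ε n u (i + 1))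
    (hlst : j + d + 1 = n → off ε n u f i = turn ε n u i ∨ off ε n u e i = false) :
    gain ε (n - 1 + 2) (spliceSeq u (i + 1) (n - 1) f) e j d = gain ε n u e (i + 1 + j) d := by
  have hn := h.three_le
  obtain ⟨m, rfl⟩ : ∃ a, n = a + 1 := ⟨n - 1, by omega⟩
  rw [Nat.add_sub_cancel]
  set w := spliceSeq u (i + 1) m f with hw
  have hwj : ∀ j, j ≤ m → w j = u (i + 1 + j) := fun j hj => splice_apply_of_le hj
  have hwf : w (m + 1) = f := splice_apply_last
  have hprev : ∀ p, 1 ≤ p → p ≤ m → w (p + (m + 2) - 1) = u (i + 1 + p + (m + 1) - 1) := by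
    intro p hp hpm
    rw [show p + (m + 2) - 1 = (p - 1) + (m + 2) by omega, hw, splice_apply_add,
      splice_apply_of_le (by omega),
      show i + 1 + p + (m + 1) - 1 = (i + 1 + (p - 1)) + (m + 1) by omega, h.periodic]
  have hturn : ∀ p, 1 ≤ p → p + 1 ≤ m → turn ε (m + 2) w p = turn ε (m + 1) u (i + 1 + p) := by
    intro p hp hpm
    rw [turn, turn, hprev p hp (by omega), hwj p (by omega), hwj (p + 1) hpm, add_assoc (i + 1) p 1]
  have hoff : ∀ p, 1 ≤ p → p ≤ m → off ε (m + 2) w e p = off ε (m + 1) u e (i + 1 + p) := by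
    intro p hp hpm
    rw [off, off, hprev p hp hpm, hwj p hpm]
  -- leaving the position `j`
  have hout : ((off ε (m + 2) w e j).toInt - (turn ε (m + 2) w j).toInt)
      = ((off ε (m + 1) u e (i + 1 + j)).toInt - (turn ε (m + 1) u (i + 1 + j)).toInt) := by
    rcases Nat.eq_zero_or_pos j with rfl | hj
    · have hp : w (0 + (m + 2) - 1) = f := by rw [show 0 + (m + 2) - 1 = m + 1 by omega, hwf]
      have hf := hfst rfl
      simp only [turn, off, bend, add_zero] at hf ⊢
      rw [hp, hwj 0 (by omega), hwj (0 + 1) (by omega), add_zero, zero_add]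
      revert hf
      generalize ε (u (i + 1)) (u (i + 1 + (m + 1) - 1)) = a
      generalize ε (u (i + 1)) e = b
      generalize ε (u (i + 1)) f = c
      generalize ε (u (i + 1)) (u (i + 1 + 1)) = d
      revert a b c d
      decide
    · rw [hturn j hj (by omega), hoff j hj (by omega)]
  -- entering the position `j + d`
  have hin : ((xor (off ε (m + 2) w e (j + d)) (turn ε (m + 2) w (j + d))).toInt
        - (turn ε (m + 2) w (j + d)).toInt)
      = ((xor (off ε (m + 1) u e (i + 1 + j + d)) (turn ε (m + 1) u (i + 1 + j + d))).toInt
        - (turn ε (m + 1) u (i + 1 + j + d)).toInt) := by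
    rcases Nat.lt_or_ge (j + d + 1) (m + 1) with hl | hl
    · rw [hturn (j + d) (by omega) (by omega), hoff (j + d) (by omega) (by omega), add_assoc (i + 1)]
    · have hjm : j + d = m := by omega
      have hlst := hlst (by omega)
      rw [hoff (j + d) (by omega) (by omega), add_assoc (i + 1), hjm,
        show i + 1 + m = i + (m + 1) by omega, h.off_add, h.turn_add]
      have ht : turn ε (m + 2) w m = off ε (m + 1) u f i := by
        rw [turn, off, hprev m (by omega) le_rfl, hwj m le_rfl, hwf,
          show i + 1 + m + (m + 1) - 1 = (i + (m + 1) - 1) + (m + 1) by omega, h.periodic,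
          show i + 1 + m = i + (m + 1) by omega, h.periodic]
      rw [ht]
      revert hlst
      generalize off ε (m + 1) u f i = a
      generalize off ε (m + 1) u e i = b
      generalize turn ε (m + 1) u i = c
      revert a b c
      decide
  have hsum : ∀ t ∈ Finset.range (d - 1), (1 + (turn ε (m + 2) w (j + 1 + t)).toInt)
      = (1 + (turn ε (m + 1) u (i + 1 + j + 1 + t)).toInt) := by
    intro t ht
    have := Finset.mem_range.1 ht
    rw [hturn (j + 1 + t) (by omega) (by omega),
      show i + 1 + (j + 1 + t) = i + 1 + j + 1 + t by omega]
  rw [gain, gain, hout, hin, Finset.sum_congr rfl hsum, hwj j (by omega), hwj (j + d) (by omega),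
    add_assoc (i + 1)]

/-- Inserting `f` between the positions `i` and `i + 1` and replacing by `e` what lies between
two positions elsewhere. -/
theorem exists_weight_add_gain_add_gain (h : IsCyclicSeq n u) {e f : ι} (hef : f ≠ e)
    (he : ∀ j, u j ≠ e) (hf : ∀ j, u j ≠ f) {i j d : ℕ} (hd : 1 ≤ d) (hjd : j + d + 1 ≤ n)
    (hfst : j = 0 → off ε n u f (i + 1) = false ∨ off ε n u e (i + 1) = turn ε n u (i + 1))
    (hlst : j + d + 1 = n → off ε n u f i = turn ε n u i ∨ off ε n u e i = false) :
    ∃ n' u', IsCyclicSeq n' u' ∧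
      weight ε n' u' = weight ε n u + gain ε n u f i 1 + gain ε n u e (i + 1 + j) d := by
  have hn := h.three_le
  have h1 := h.splice (i + 1) (m := n - 1) (by omega) (by omega) hf
  have hw := h.weight_splice (ε := ε) i (m := n - 1) (d := 1) (by omega) le_rfl (by omega) f
  have he' : ∀ p, spliceSeq u (i + 1) (n - 1) f p ≠ e := by
    intro p
    rw [spliceSeq]
    split_ifs
    exacts [hef, he _]
  obtain ⟨u', hu', hwu'⟩ := h1.exists_weight_add_gain (ε := ε) he' j hd (by omega)
  exact ⟨_, u', hu', by rw [hwu', hw, h.gain_splice hd hjd hfst hlst]⟩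

/-! ### Reversal and parity -/

/-- A cyclic sequence may be read backwards. -/
theorem reverse (h : IsCyclicSeq n u) : IsCyclicSeq n fun j => u (n - 1 - j % n) where
  three_le := h.three_le
  periodic j := by simp
  inj i hi j hj hij := by
    simp only [Nat.mod_eq_of_lt hi, Nat.mod_eq_of_lt hj] at hij
    have := h.inj _ (by omega) _ (by omega) hij
    omega

theorem reverse_neighbours (h : IsCyclicSeq n u) {j : ℕ} (hj : j < n) :
    u (n - 1 - (j + n - 1) % n) = u (n - 1 - j + 1) ∧
      u (n - 1 - (j + 1) % n) = u (n - 1 - j + n - 1) := by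
  have hn := h.three_le
  constructor
  · rcases Nat.eq_zero_or_pos j with rfl | h0
    · rw [show 0 + n - 1 = n - 1 by omega, Nat.mod_eq_of_lt (by omega),
        show n - 1 - 0 + 1 = 0 + n by omega, h.periodic]
      congr 1
      omega
    · rw [show j + n - 1 = (j - 1) + n by omega, Nat.add_mod_right, Nat.mod_eq_of_lt (by omega)]
      congr 1
      omega
  · rcases Nat.lt_or_ge (j + 1) n with hl | hl
    · rw [Nat.mod_eq_of_lt hl, show n - 1 - j + n - 1 = (n - 1 - (j + 1)) + n by omega, h.periodic]
    · obtain rfl : j = n - 1 := by omega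
      rw [show n - 1 + 1 = n by omega, Nat.mod_self]
      congr 1
      omega

theorem turn_reverse (h : IsCyclicSeq n u) {j : ℕ} (hj : j < n) :
    turn ε n (fun j => u (n - 1 - j % n)) j = turn ε n u (n - 1 - j) := by
  obtain ⟨h1, h2⟩ := h.reverse_neighbours hj
  simp only [turn, bend, h1, h2, Nat.mod_eq_of_lt hj]
  exact Bool.xor_comm _ _

theorem off_reverse (h : IsCyclicSeq n u) (e : ι) {j : ℕ} (hj : j < n) :
    off ε n (fun j => u (n - 1 - j % n)) e j
      = xor (off ε n u e (n - 1 - j)) (turn ε n u (n - 1 - j)) := by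
  obtain ⟨h1, -⟩ := h.reverse_neighbours hj
  simp only [turn, off, bend, h1, Nat.mod_eq_of_lt hj]
  generalize ε _ _ = a
  generalize ε _ _ = b
  generalize ε _ _ = c
  revert a b c
  decide

theorem weight_reverse (h : IsCyclicSeq n u) :
    weight ε n (fun j => u (n - 1 - j % n)) = weight ε n u := by
  rw [weight, weight, ← Finset.sum_range_reflect (fun j => 1 + (turn ε n u j).toInt)]
  exact Finset.sum_congr rfl fun j hj => by rw [h.turn_reverse (Finset.mem_range.1 hj)]

/-- The weight of a cyclic sequence has the parity of the sum of the gains of all insertions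
of `e`. In particular it is even if all these gains are. -/
theorem even_weight_of_even_gain (h : IsCyclicSeq n u) (e : ι)
    (hg : ∀ i, Even (gain ε n u e i 1)) : Even (weight ε n u) := by
  -- the triangle formed by `e` and two consecutive terms compares this quantity at both of them
  let b : ℕ → ℤ := fun j => (xor (ε e (u j)) (off ε n u e j)).toInt
  have hstep : ∀ j, Even ((1 + (turn ε n u j).toInt) - (b j + b (j + 1))) := by
    intro j
    have := hg j
    simp only [gain, Nat.sub_self, Finset.range_zero, Finset.sum_empty] at this
    simp only [b]
    revert this
    generalize ε e (u j) = a1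
    generalize ε e (u (j + 1)) = a2
    generalize off ε n u e j = a3
    generalize off ε n u e (j + 1) = a4
    generalize turn ε n u j = a5
    generalize turn ε n u (j + 1) = a6
    revert a1 a2 a3 a4 a5 a6
    decide
  have hshift : ∑ j ∈ Finset.range n, b (j + 1) = ∑ j ∈ Finset.range n, b j := by
    have := sum_range_shift_of_periodic (f := b) (n := n)
      (fun j => by simp only [b, h.periodic, h.off_add]) 1
    simpa only [add_comm] using this
  have hsum : Even (∑ j ∈ Finset.range n, ((1 + (turn ε n u j).toInt) - (b j + b (j + 1)))) :=
    Finset.even_sum _ fun j _ => hstep j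
  rw [Finset.sum_sub_distrib, Finset.sum_add_distrib (f := b), hshift] at hsum
  have := hsum.add (Even.add_self (∑ j ∈ Finset.range n, b j))
  rwa [sub_add_cancel] at this

end IsCyclicSeq

end CyclicSequences

/-! ### Gains in terms of local data -/

section CyclicSequences

variable {ι : Type*}

/-- The gain of a replacement as a function of the two positions `(t, g, c)` and `(t', g', c')`
where the new matching edge `e` is attached and of the weight `w` of what it replaces. At either
position, `t` tells whether the sequence turns there, `g` whether it would turn when leaving towards
`e`, and `c` is the end of `e` used. -/
def localGain (t g c t' g' c' : Bool) (w : ℤ) : ℤ :=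
  1 + (xor c c').toInt + (g.toInt - t.toInt) + ((xor g' t').toInt - t'.toInt) - w

variable {ε : ι → ι → Bool} {n : ℕ} {u : ℕ → ι}

theorem gain_one (e : ι) (i : ℕ) : gain ε n u e i 1 =
    localGain (turn ε n u i) (off ε n u e i) (ε e (u i))
      (turn ε n u (i + 1)) (off ε n u e (i + 1)) (ε e (u (i + 1))) 0 := by
  simp [gain, localGain]

theorem gain_two (e : ι) (i : ℕ) : gain ε n u e i 2 =
    localGain (turn ε n u i) (off ε n u e i) (ε e (u i))
      (turn ε n u (i + 2)) (off ε n u e (i + 2)) (ε e (u (i + 2)))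
      (1 + (turn ε n u (i + 1)).toInt) := by
  simp [gain, localGain]

theorem gain_three (e : ι) (i : ℕ) : gain ε n u e i 3 =
    localGain (turn ε n u i) (off ε n u e i) (ε e (u i))
      (turn ε n u (i + 3)) (off ε n u e (i + 3)) (ε e (u (i + 3)))
      (1 + (turn ε n u (i + 1)).toInt + (1 + (turn ε n u (i + 2)).toInt)) := by
  simp [gain, localGain, Finset.sum_range_succ]

theorem gain_four (e : ι) (i : ℕ) : gain ε n u e i 4 =
    localGain (turn ε n u i) (off ε n u e i) (ε e (u i))
      (turn ε n u (i + 4)) (off ε n u e (i + 4)) (ε e (u (i + 4)))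
      (1 + (turn ε n u (i + 1)).toInt + (1 + (turn ε n u (i + 2)).toInt)
        + (1 + (turn ε n u (i + 3)).toInt)) := by
  simp [gain, localGain, Finset.sum_range_succ]

/-! ### Case analysis of short windows -/

/-- If two consecutive insertions of `e` each lose weight or gain at least `4`, then putting `e` in
place of the term between them gains `1`, `2` or `3`. -/
theorem localGain_window_three : ∀ t₀ g₀ c₀ t₁ g₁ c₁ : Bool,
    (localGain t₀ g₀ c₀ t₁ g₁ c₁ 0 < 0 ∨ 4 ≤ localGain t₀ g₀ c₀ t₁ g₁ c₁ 0) →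
    ∀ t₂ g₂ c₂ : Bool,
    (localGain t₁ g₁ c₁ t₂ g₂ c₂ 0 < 0 ∨ 4 ≤ localGain t₁ g₁ c₁ t₂ g₂ c₂ 0) →
    ¬(localGain t₀ g₀ c₀ t₂ g₂ c₂ (1 + t₁.toInt) ≤ 0 ∨
      4 ≤ localGain t₀ g₀ c₀ t₂ g₂ c₂ (1 + t₁.toInt)) := by
  decide

set_option synthInstance.maxSize 1000 in
set_option synthInstance.maxHeartbeats 400000 in
set_option maxRecDepth 10000 in
/-- If no replacement within five consecutive terms gains `±1`, the first insertion has even gain.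
The hypotheses are ordered so that cases are discarded as soon as possible. -/
theorem even_localGain_of_window_five : ∀ t₀ g₀ c₀ t₁ g₁ c₁ : Bool,
    (localGain t₀ g₀ c₀ t₁ g₁ c₁ 0).natAbs ≠ 1 →
    ¬Even (localGain t₀ g₀ c₀ t₁ g₁ c₁ 0) →
    ∀ t₂ g₂ c₂ : Bool,
    (localGain t₁ g₁ c₁ t₂ g₂ c₂ 0).natAbs ≠ 1 →
    (localGain t₀ g₀ c₀ t₂ g₂ c₂ (1 + t₁.toInt)).natAbs ≠ 1 →
    ∀ t₃ g₃ c₃ : Bool,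
    (localGain t₂ g₂ c₂ t₃ g₃ c₃ 0).natAbs ≠ 1 →
    (localGain t₁ g₁ c₁ t₃ g₃ c₃ (1 + t₂.toInt)).natAbs ≠ 1 →
    (localGain t₀ g₀ c₀ t₃ g₃ c₃ (1 + t₁.toInt + (1 + t₂.toInt))).natAbs ≠ 1 →
    ∀ t₄ g₄ c₄ : Bool,
    (localGain t₃ g₃ c₃ t₄ g₄ c₄ 0).natAbs ≠ 1 →
    (localGain t₂ g₂ c₂ t₄ g₄ c₄ (1 + t₃.toInt)).natAbs ≠ 1 →
    (localGain t₁ g₁ c₁ t₄ g₄ c₄ (1 + t₂.toInt + (1 + t₃.toInt))).natAbs ≠ 1 →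
    ¬(localGain t₀ g₀ c₀ t₄ g₄ c₄
      (1 + t₁.toInt + (1 + t₂.toInt) + (1 + t₃.toInt))).natAbs ≠ 1 := by
  decide

set_option synthInstance.maxSize 1000 in
set_option synthInstance.maxHeartbeats 400000 in
set_option maxRecDepth 10000 in
/-- The analogue of `even_localGain_of_window_five` for sequences of period four. -/
theorem even_localGain_of_cyclic_four : ∀ t₀ g₀ c₀ t₁ g₁ c₁ : Bool,
    (localGain t₀ g₀ c₀ t₁ g₁ c₁ 0).natAbs ≠ 1 →
    ¬Even (localGain t₀ g₀ c₀ t₁ g₁ c₁ 0) →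
    ∀ t₂ g₂ c₂ : Bool,
    (localGain t₁ g₁ c₁ t₂ g₂ c₂ 0).natAbs ≠ 1 →
    (localGain t₀ g₀ c₀ t₂ g₂ c₂ (1 + t₁.toInt)).natAbs ≠ 1 →
    ∀ t₃ g₃ c₃ : Bool,
    (localGain t₂ g₂ c₂ t₃ g₃ c₃ 0).natAbs ≠ 1 →
    (localGain t₁ g₁ c₁ t₃ g₃ c₃ (1 + t₂.toInt)).natAbs ≠ 1 →
    (localGain t₀ g₀ c₀ t₃ g₃ c₃ (1 + t₁.toInt + (1 + t₂.toInt))).natAbs ≠ 1 →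
    (localGain t₃ g₃ c₃ t₀ g₀ c₀ 0).natAbs ≠ 1 →
    (localGain t₂ g₂ c₂ t₀ g₀ c₀ (1 + t₃.toInt)).natAbs ≠ 1 →
    (localGain t₁ g₁ c₁ t₀ g₀ c₀ (1 + t₂.toInt + (1 + t₃.toInt))).natAbs ≠ 1 →
    (localGain t₃ g₃ c₃ t₁ g₁ c₁ (1 + t₀.toInt)).natAbs ≠ 1 →
    (localGain t₂ g₂ c₂ t₁ g₁ c₁ (1 + t₃.toInt + (1 + t₀.toInt))).natAbs ≠ 1 →
    ¬(localGain t₃ g₃ c₃ t₂ g₂ c₂ (1 + t₀.toInt + (1 + t₁.toInt))).natAbs ≠ 1 := by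
  decide

/-- The analogue of `even_localGain_of_window_five` for sequences of period three. An odd weight
means zero or two turns; zero turns would be a genuine exception. -/
theorem even_localGain_of_cyclic_three : ∀ t₀ g₀ c₀ t₁ g₁ c₁ : Bool,
    (localGain t₀ g₀ c₀ t₁ g₁ c₁ 0).natAbs ≠ 1 →
    ¬Even (localGain t₀ g₀ c₀ t₁ g₁ c₁ 0) →
    ∀ t₂ g₂ c₂ : Bool,
    (localGain t₁ g₁ c₁ t₂ g₂ c₂ 0).natAbs ≠ 1 →
    (localGain t₂ g₂ c₂ t₀ g₀ c₀ 0).natAbs ≠ 1 →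
    (localGain t₀ g₀ c₀ t₂ g₂ c₂ (1 + t₁.toInt)).natAbs ≠ 1 →
    (localGain t₁ g₁ c₁ t₀ g₀ c₀ (1 + t₂.toInt)).natAbs ≠ 1 →
    (localGain t₂ g₂ c₂ t₁ g₁ c₁ (1 + t₀.toInt)).natAbs ≠ 1 →
    t₀.toInt + t₁.toInt + t₂.toInt ≠ 2 := by
  decide

end CyclicSequences

section CyclicSequences

variable {ι : Type*} {ε : ι → ι → Bool} {n : ℕ} {u : ℕ → ι}

/-! ### Extremal cyclic sequences -/

/-- The elements that a sequence does not visit. -/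
def unvisited (u : ℕ → ι) : Set ι := {e | ∀ j, u j ≠ e}

theorem IsCyclicSeq.le_card_unvisited [Fintype ι] (h : IsCyclicSeq n u) :
    ∃ s : Finset ι, (∀ e ∈ s, e ∈ unvisited u) ∧ Fintype.card ι = n + s.card := by
  classical
  refine ⟨((Finset.range n).image u)ᶜ, ?_, ?_⟩
  · intro e he j hj
    refine Finset.mem_compl.1 he (Finset.mem_image.2 ⟨j % n, ?_, by rw [h.apply_mod, hj]⟩)
    exact Finset.mem_range.2 (Nat.mod_lt _ (by have := h.three_le; omega))
  · rw [Finset.card_compl, Finset.card_image_of_injOn, Finset.card_range]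
    · have : n ≤ Fintype.card ι := by
        have h1 := Finset.card_le_univ ((Finset.range n).image u)
        rwa [Finset.card_image_of_injOn, Finset.card_range] at h1
        intro i hi j hj hij
        exact h.inj i (by simpa using hi) j (by simpa using hj) hij
      omega
    · intro i hi j hj hij
      exact h.inj i (by simpa using hi) j (by simpa using hj) hij

/-- Among the cyclic sequences of a given weight there is one of greatest period, i.e. with the
fewest turns. -/
theorem exists_longest_of_weight (h : IsCyclicSeq n u) :
    ∃ n' u', IsCyclicSeq n' u' ∧ weight ε n' u' = weight ε n u ∧
      ∀ m v, IsCyclicSeq m v → weight ε m v = weight ε n u → m ≤ n' := by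
  obtain ⟨z, ⟨n', u', h', hw', rfl⟩, hz⟩ := Int.exists_greatest_of_bdd
    (P := fun z => ∃ n' u', IsCyclicSeq n' u' ∧ weight ε n' u' = weight ε n u ∧ (n' : ℤ) = z)
    ⟨weight ε n u, by
      rintro _ ⟨n', u', -, hw, rfl⟩
      rw [← hw]
      exact IsCyclicSeq.le_weight⟩ ⟨n, n, u, h, rfl, rfl⟩
  exact ⟨n', u', h', hw', fun m v hv hwv => by exact_mod_cast hz m ⟨m, v, hv, hwv, rfl⟩⟩

theorem exists_isCyclicSeq_three [Fintype ι] (hcard : 3 ≤ Fintype.card ι) :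
    ∃ u : ℕ → ι, IsCyclicSeq 3 u := by
  obtain ⟨f⟩ : Nonempty (Fin 3 ↪ ι) := Function.Embedding.nonempty_of_card_le (by simpa)
  refine ⟨fun j => f ⟨j % 3, Nat.mod_lt _ (by omega)⟩, le_rfl, fun j => by simp, ?_⟩
  intro i hi j hj hij
  have := f.injective hij
  simp only [Fin.mk.injEq] at this
  omega

/-- A cyclic sequence of greatest weight subject to being at most `2k` has weight at least
`2k - 2`: otherwise every insertion would shorten it or gain at least `4`. -/
theorem exists_weight_near [Fintype ι] (ε : ι → ι → Bool) {k : ℕ} (hk : 3 ≤ k)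
    (hcard : Fintype.card ι = 2 * k) :
    ∃ n u, IsCyclicSeq n u ∧ weight ε n u ≤ 2 * k ∧ (2 * k - 2 : ℤ) ≤ weight ε n u := by
  obtain ⟨u₀, h₀⟩ := exists_isCyclicSeq_three (ι := ι) (by omega)
  obtain ⟨z, ⟨n₁, u₁, h₁, hw₁, rfl⟩, hz⟩ := Int.exists_greatest_of_bdd
    (P := fun z => ∃ n u, IsCyclicSeq n u ∧ weight ε n u ≤ 2 * k ∧ weight ε n u = z)
    ⟨2 * k, by rintro _ ⟨n, u, -, hw, rfl⟩; exact hw⟩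
    ⟨_, 3, u₀, h₀, (IsCyclicSeq.weight_le (ε := ε) (n := 3) (u := u₀)).trans (by norm_num; omega), rfl⟩
  refine ⟨n₁, u₁, h₁, hw₁, ?_⟩
  by_contra! hlt
  obtain ⟨n, u, h, hw, hmax⟩ := exists_longest_of_weight (ε := ε) h₁
  have hn := h.three_le
  have hnw : (n : ℤ) ≤ weight ε n u := IsCyclicSeq.le_weight
  obtain ⟨s, hs, hsc⟩ := h.le_card_unvisited
  obtain ⟨e, he⟩ : s.Nonempty := Finset.card_pos.1 (by omega)
  have hgain : ∀ i d, 1 ≤ d → d + 1 ≤ n →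
      gain ε n u e i d ≤ 0 ∨ 4 ≤ gain ε n u e i d := by
    intro i d hd hdn
    by_contra! hg
    obtain ⟨u', h', hw'⟩ := h.exists_weight_add_gain (ε := ε) (hs e he) i hd hdn
    have := hz _ ⟨_, u', h', by rw [hw', hw]; omega, rfl⟩
    rw [hw', hw] at this
    omega
  have hgain_one : ∀ i, gain ε n u e i 1 < 0 ∨ 4 ≤ gain ε n u e i 1 := by
    intro i
    rcases hgain i 1 le_rfl (by omega) with hg | hg
    · rcases hg.lt_or_eq with hg | hg
      · exact Or.inl hg
      · obtain ⟨u', h', hw'⟩ := h.exists_weight_add_gain (ε := ε) (hs e he) i le_rfl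
          (show 1 + 1 ≤ n by omega)
        have := hmax _ u' h' (by rw [hw', hg, hw, add_zero])
        omega
    · exact Or.inr hg
  have h01 := hgain_one 0
  have h12 := hgain_one 1
  have h02 := hgain 0 2 (by omega) (by omega)
  rw [gain_one] at h01 h12
  rw [gain_two] at h02
  exact localGain_window_three _ _ _ _ _ _ h01 _ _ _ h12 h02

/-- If no replacement by `e` changes the weight by one, all insertions of `e` have even gain, and
so the weight is even. -/
theorem even_weight_of_natAbs_gain_ne_one (h : IsCyclicSeq n u) (hw : weight ε n u ≠ 3) (e : ι)
    (hg : ∀ i d, 1 ≤ d → d + 1 ≤ n → (gain ε n u e i d).natAbs ≠ 1) :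
    Even (weight ε n u) := by
  have hn := h.three_le
  by_contra hodd
  refine hodd (h.even_weight_of_even_gain e fun i => ?_)
  by_contra hev
  have g1 := fun i => gain_one (ε := ε) (n := n) (u := u) e i ▸ hg i 1 le_rfl (by omega)
  have g2 := fun i => gain_two (ε := ε) (n := n) (u := u) e i ▸ hg i 2 (by omega) (by omega)
  rw [gain_one] at hev
  rcases (show n = 3 ∨ n = 4 ∨ 5 ≤ n by omega) with rfl | rfl | hn5
  · have a1 := g1 (i + 2)
    have b1 := g2 (i + 1)
    have b2 := g2 (i + 2)
    simp only [show i + 2 + 1 = i + 3 by omega,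
      show i + 2 + 2 = i + 1 + 3 by omega, show i + 1 + 1 = i + 2 by omega,
      h.turn_add, h.off_add, h.periodic] at a1 b1 b2
    have hsum := even_localGain_of_cyclic_three _ _ _ _ _ _ (g1 i) hev _ _ _ (g1 (i + 1)) a1 (g2 i)
      b1 b2
    have hwt : weight ε 3 u = 3 + ((turn ε 3 u i).toInt + (turn ε 3 u (i + 1)).toInt
        + (turn ε 3 u (i + 2)).toInt) := by
      rw [h.weight_eq_sum_shift i]
      simp only [Finset.sum_range_succ, Finset.sum_range_zero, add_zero]
      ring
    revert hsum hwt hw hodd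
    generalize turn ε 3 u i = a
    generalize turn ε 3 u (i + 1) = b
    generalize turn ε 3 u (i + 2) = c
    intro hw hodd hsum hwt
    rw [hwt] at hodd hw
    clear hwt
    revert a b c
    decide
  · have g3 := fun i => gain_three (ε := ε) (n := 4) (u := u) e i ▸ hg i 3 (by omega) (by omega)
    have a1 := g1 (i + 3)
    have b1 := g2 (i + 2)
    have b2 := g2 (i + 3)
    have d1 := g3 (i + 1)
    have d2 := g3 (i + 2)
    have d3 := g3 (i + 3)
    simp only [show i + 3 + 1 = i + 4 by omega, show i + 3 + 2 = i + 1 + 4 by omega,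
      show i + 3 + 3 = i + 2 + 4 by omega, show i + 1 + 1 = i + 2 by omega,
      show i + 1 + 2 = i + 3 by omega, h.turn_add, h.off_add, h.periodic] at a1 b1 b2 d1 d2 d3
    exact even_localGain_of_cyclic_four _ _ _ _ _ _ (g1 i) hev _ _ _ (g1 (i + 1)) (g2 i) _ _ _
      (g1 (i + 2)) (g2 (i + 1)) (g3 i) a1 b1 d1 b2 d2 d3
  · have g3 := fun i => gain_three (ε := ε) (n := n) (u := u) e i ▸ hg i 3 (by omega) (by omega)
    have g4 := fun i => gain_four (ε := ε) (n := n) (u := u) e i ▸ hg i 4 (by omega) (by omega)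
    exact even_localGain_of_window_five _ _ _ _ _ _ (g1 i) hev _ _ _ (g1 (i + 1)) (g2 i) _ _ _
      (g1 (i + 2)) (g2 (i + 1)) (g3 i) _ _ _ (g1 (i + 3)) (g2 (i + 2)) (g3 (i + 1)) (g4 i)

end CyclicSequences

section CyclicSequences

variable {ι : Type*} {ε : ι → ι → Bool} {n : ℕ} {u : ℕ → ι}

/-- A cyclic sequence which is longest among those of its weight, such that no cyclic sequence
exceeds its weight by exactly two. -/
structure IsExtremalSeq (ε : ι → ι → Bool) (n : ℕ) (u : ℕ → ι) : Prop where
  seq : IsCyclicSeq n u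
  longest : ∀ m v, IsCyclicSeq m v → weight ε m v = weight ε n u → m ≤ n
  no_add_two : ∀ m v, IsCyclicSeq m v → weight ε m v ≠ weight ε n u + 2

namespace IsExtremalSeq

variable {e f : ι}

theorem shift (h : IsExtremalSeq ε n u) (s : ℕ) : IsExtremalSeq ε n fun j => u (s + j) where
  seq := h.seq.shift s
  longest m v hv hw := h.longest m v hv (by rw [hw, h.seq.weight_shift])
  no_add_two m v hv := by rw [h.seq.weight_shift]; exact h.no_add_two m v hv

theorem reverse (h : IsExtremalSeq ε n u) : IsExtremalSeq ε n fun j => u (n - 1 - j % n) where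
  seq := h.seq.reverse
  longest m v hv hw := h.longest m v hv (by rw [hw, h.seq.weight_reverse])
  no_add_two m v hv := by rw [h.seq.weight_reverse]; exact h.no_add_two m v hv

theorem gain_ne_two (h : IsExtremalSeq ε n u) (he : e ∈ unvisited u) {i d : ℕ} (hd : 1 ≤ d)
    (hdn : d + 1 ≤ n) : gain ε n u e i d ≠ 2 := fun hg => by
  obtain ⟨u', hu', hw⟩ := h.seq.exists_weight_add_gain (ε := ε) he i hd hdn
  exact h.no_add_two _ _ hu' (by rw [hw, hg])

theorem gain_one_ne_two (h : IsExtremalSeq ε n u) (he : e ∈ unvisited u) (i : ℕ) :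
    gain ε n u e i 1 ≠ 2 :=
  h.gain_ne_two he le_rfl (by have := h.seq.three_le; omega)

/-- An insertion of gain zero would give a longer sequence of the same weight. -/
theorem gain_one_ne_zero (h : IsExtremalSeq ε n u) (he : e ∈ unvisited u) (i : ℕ) :
    gain ε n u e i 1 ≠ 0 := fun hg => by
  have hn := h.seq.three_le
  obtain ⟨u', hu', hw⟩ := h.seq.exists_weight_add_gain (ε := ε) he i le_rfl
    (show 1 + 1 ≤ n by omega)
  have := h.longest _ _ hu' (by rw [hw, hg, add_zero])
  omega

theorem gain_add_gain_ne_two (h : IsExtremalSeq ε n u) (hef : e ≠ f) (he : e ∈ unvisited u)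
    (hf : f ∈ unvisited u) {i j d : ℕ} (hd : 1 ≤ d) (hjd : j + d + 1 ≤ n)
    (hfst : j = 0 → off ε n u e (i + 1) = false ∨ off ε n u f (i + 1) = turn ε n u (i + 1))
    (hlst : j + d + 1 = n → off ε n u e i = turn ε n u i ∨ off ε n u f i = false) :
    gain ε n u e i 1 + gain ε n u f (i + 1 + j) d ≠ 2 := fun hg => by
  obtain ⟨m, v, hv, hw⟩ := h.seq.exists_weight_add_gain_add_gain (ε := ε) hef hf he hd hjd hfst hlst
  exact h.no_add_two _ _ hv (by rw [hw, ← hg, add_assoc])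

/-- Insertions of `e` and `f` on the two sides of a common position. -/
theorem gain_add_gain_succ_ne_two (h : IsExtremalSeq ε n u) (hef : e ≠ f) (he : e ∈ unvisited u)
    (hf : f ∈ unvisited u) {i : ℕ}
    (hi : off ε n u e (i + 1) = false ∨ off ε n u f (i + 1) = turn ε n u (i + 1)) :
    gain ε n u e i 1 + gain ε n u f (i + 1) 1 ≠ 2 := by
  have hn := h.seq.three_le
  exact h.gain_add_gain_ne_two hef he hf (j := 0) le_rfl (by omega) (fun _ => hi) (by omega)

/-! ### Extremal sequences without turns -/

/-- Without turns, an insertion of gain one forces `e` to be attached by the same end to the used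
end of all terms. -/
theorem gain_one_eq_one_of_turn_eq_false (h : IsExtremalSeq ε n u) (he : e ∈ unvisited u)
    (ht : ∀ i, turn ε n u i = false) {i : ℕ} (hi : gain ε n u e i 1 = 1) (j : ℕ) :
    gain ε n u e (i + j) 1 = 1 := by
  have hn := h.seq.three_le
  induction j with
  | zero => exact hi
  | succ j ih =>
    have h0 := h.gain_one_ne_two he (i + j + 1)
    have h2 := h.gain_ne_two he (i := i + j) (d := 2) (by omega) (by omega)
    rw [← add_assoc]
    rw [gain_one] at ih h0 ⊢
    rw [gain_two] at h2
    simp only [ht] at ih h0 h2 ⊢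
    revert ih h0 h2
    generalize off ε n u e (i + j) = g0
    generalize off ε n u e (i + j + 1) = g1
    generalize off ε n u e (i + j + 2) = g2
    generalize ε e (u (i + j)) = c0
    generalize ε e (u (i + j + 1)) = c1
    generalize ε e (u (i + j + 2)) = c2
    revert g0 g1 g2 c0 c1 c2
    decide

theorem exists_gain_one_eq_one_of_turn_eq_false (h : IsExtremalSeq ε n u) (hn : 4 ≤ n)
    (he : e ∈ unvisited u) (ht : ∀ i, turn ε n u i = false) :
    ∃ i, gain ε n u e i 1 = 1 := by
  by_contra! hno
  have h1 : ∀ i, off ε n u e (i + 1) = true := by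
    intro i
    have a0 := hno i
    have a1 := hno (i + 1)
    have b0 := h.gain_one_ne_two he i
    have b1 := h.gain_one_ne_two he (i + 1)
    have d2 := h.gain_ne_two he (i := i) (d := 2) (by omega) (by omega)
    rw [gain_one] at a0 a1 b0 b1
    rw [gain_two] at d2
    simp only [ht] at a0 a1 b0 b1 d2
    revert a0 a1 b0 b1 d2
    generalize off ε n u e i = g0
    generalize off ε n u e (i + 1) = g1
    generalize off ε n u e (i + 2) = g2
    generalize ε e (u i) = c0
    generalize ε e (u (i + 1)) = c1
    generalize ε e (u (i + 2)) = c2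
    revert g0 g1 g2 c0 c1 c2
    decide
  have h2 : ∀ i, ε e (u (i + 1 + 2)) = !ε e (u (i + 1)) := by
    intro i
    have d2 := h.gain_ne_two he (i := i + 1) (d := 2) (by omega) (by omega)
    rw [gain_two] at d2
    simp only [ht, h1, show i + 1 + 2 = i + 2 + 1 by omega] at d2 ⊢
    revert d2
    generalize ε e (u (i + 1)) = c0
    generalize ε e (u (i + 2 + 1)) = c2
    revert c0 c2
    decide
  have h3 : ∀ i, ε e (u (i + 1 + 3)) = ε e (u (i + 1)) := by
    intro i
    have d3 := h.gain_ne_two he (i := i + 1) (d := 3) (by omega) (by omega)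
    rw [gain_three] at d3
    simp only [ht, h1, show i + 1 + 3 = i + 3 + 1 by omega] at d3 ⊢
    revert d3
    generalize ε e (u (i + 1)) = c0
    generalize ε e (u (i + 3 + 1)) = c3
    revert c0 c3
    decide
  -- six steps ahead is three changes by the one and no change by the other
  have e1 := h3 3
  have e2 := h3 0
  have e3 := h2 4
  have e4 := h2 2
  have e5 := h2 0
  norm_num at e1 e2 e3 e4 e5
  simp [e1, e2, e4, e5] at e3

theorem exists_turn (h : IsExtremalSeq ε n u) (hn : 4 ≤ n) (hef : e ≠ f) (he : e ∈ unvisited u)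
    (hf : f ∈ unvisited u) : ∃ i, turn ε n u i = true := by
  by_contra! ht
  simp only [ne_eq, Bool.not_eq_true] at ht
  obtain ⟨i, hi⟩ := h.exists_gain_one_eq_one_of_turn_eq_false hn he ht
  obtain ⟨j, hj⟩ := h.exists_gain_one_eq_one_of_turn_eq_false hn hf ht
  -- both have gain one everywhere, in particular at two disjoint places
  have h1 := h.gain_one_eq_one_of_turn_eq_false he ht hi j
  have h2 := h.gain_one_eq_one_of_turn_eq_false hf ht hj (i + 2)
  refine h.gain_add_gain_ne_two hef he hf (i := i + j) (j := 1) (d := 1) le_rfl (by omega)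
    (by omega) (by omega) ?_
  rw [h1, show i + j + 1 + 1 = j + (i + 2) by omega, h2]
  norm_num

/-! ### Extremal sequences with turns -/

theorem localGain_eq_neg_one : ∀ t g c t' g' c' : Bool, localGain t g c t' g' c' 0 = -1 →
    t = true ∧ g = false ∧ t' = true ∧ g' = true := by
  decide

/-- Two new matching edges cannot both be attached to two consecutive turns at their outer ends. -/
theorem not_outer_outer (h : IsExtremalSeq ε n u) (hef : e ≠ f) (he : e ∈ unvisited u)
    (hf : f ∈ unvisited u) {i : ℕ} (hi : gain ε n u e (i + 1) 1 = -1)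
    (hj : gain ε n u f (i + 1) 1 = -1) : False := by
  have hn := h.seq.three_le
  obtain ⟨ht1, he1, ht2, he2⟩ := localGain_eq_neg_one _ _ _ _ _ _ (gain_one (ε := ε) e (i + 1) ▸ hi)
  obtain ⟨-, hf1, -, hf2⟩ := localGain_eq_neg_one _ _ _ _ _ _ (gain_one (ε := ε) f (i + 1) ▸ hj)
  -- both gain one on either side of the two turns
  have before : ∀ {a b : ι}, a ≠ b → a ∈ unvisited u → b ∈ unvisited u →
      off ε n u a (i + 1) = false → gain ε n u b (i + 1) 1 = -1 → gain ε n u a i 1 = 1 := by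
    intro a b hab ha hb hoa hgb
    have hadd := h.gain_add_gain_succ_ne_two hab ha hb (i := i) (Or.inl hoa)
    have h0 := h.gain_one_ne_zero ha i
    have h2 := h.gain_one_ne_two ha i
    rw [hgb] at hadd
    rw [gain_one, hoa, ht1] at hadd h0 h2 ⊢
    revert hadd h0 h2
    generalize turn ε n u i = t
    generalize off ε n u a i = g
    generalize ε a (u i) = c
    generalize ε a (u (i + 1)) = c'
    revert t g c c'
    decide
  have after : ∀ {a b : ι}, a ≠ b → a ∈ unvisited u → b ∈ unvisited u →
      off ε n u b (i + 2) = true → gain ε n u a (i + 1) 1 = -1 → gain ε n u b (i + 2) 1 = 1 := by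
    intro a b hab ha hb hob hga
    have hadd := h.gain_add_gain_succ_ne_two hab ha hb (i := i + 1) (Or.inr (by rw [hob, ht2]))
    have h0 := h.gain_one_ne_zero hb (i + 2)
    have h2 := h.gain_one_ne_two hb (i + 2)
    rw [hga] at hadd
    rw [gain_one, show i + 1 + 1 = i + 2 by omega, hob, ht2] at hadd
    rw [gain_one, hob, ht2] at h0 h2 ⊢
    revert hadd h0 h2
    generalize turn ε n u (i + 2 + 1) = t
    generalize off ε n u b (i + 2 + 1) = g
    generalize ε b (u (i + 2)) = c
    generalize ε b (u (i + 2 + 1)) = c'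
    revert t g c c'
    decide
  have ge0 := before hef he hf he1 hj
  have gf0 := before hef.symm hf he hf1 hi
  have ge2 := after hef.symm hf he he2 hj
  have gf2 := after hef he hf hf2 hi
  rcases (show n = 3 ∨ 4 ≤ n by omega) with rfl | hn4
  · -- the two insertions meet in the third term, where one of the two orders is possible
    have hp : ∀ a, gain ε 3 u a (i + 2 + 1) 1 = gain ε 3 u a i 1 := fun a => by
      rw [show i + 2 + 1 = i + 3 by omega, h.seq.gain_add]
    have n1 : ¬(off ε 3 u e i = false ∨ off ε 3 u f i = turn ε 3 u i) := by
      intro hc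
      refine h.gain_add_gain_succ_ne_two hef he hf (i := i + 2) ?_ (by rw [ge2, hp, gf0]; norm_num)
      rwa [show i + 2 + 1 = i + 3 by omega, h.seq.turn_add, h.seq.off_add, h.seq.off_add]
    have n2 : ¬(off ε 3 u f i = false ∨ off ε 3 u e i = turn ε 3 u i) := by
      intro hc
      refine h.gain_add_gain_succ_ne_two hef.symm hf he (i := i + 2) ?_
        (by rw [gf2, hp, ge0]; norm_num)
      rwa [show i + 2 + 1 = i + 3 by omega, h.seq.turn_add, h.seq.off_add, h.seq.off_add]
    rw [gain_one, he1, ht1] at ge0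
    revert n1 n2 ge0
    generalize off ε 3 u e i = a
    generalize off ε 3 u f i = b
    generalize turn ε 3 u i = c
    generalize ε e (u i) = d
    generalize ε e (u (i + 1)) = d'
    revert a b c d d'
    decide
  · exact h.gain_add_gain_ne_two hef he hf (i := i) (j := 1) le_rfl (by omega) (by omega)
      (by omega) (by rw [ge0, show i + 1 + 1 = i + 2 by omega, gf2]; norm_num)

end IsExtremalSeq

end CyclicSequences

section CyclicSequences

variable {ι : Type*} {ε : ι → ι → Bool} {n : ℕ} {u : ℕ → ι}

namespace IsExtremalSeq

variable {e f : ι}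

/-- An insertion of gain `-1` is an outer attachment of `f` to two consecutive turns. Then two
further new edges have to be attached to the inner ends of these turns, and so to the outer ends
of the preceding pair of terms. -/
theorem gain_one_ne_neg_one_succ (h : IsExtremalSeq ε n u) {e₁ e₂ : ι} (hf : f ∈ unvisited u)
    (he₁ : e₁ ∈ unvisited u) (he₂ : e₂ ∈ unvisited u) (h₁ : f ≠ e₁) (h₂ : f ≠ e₂) (h₁₂ : e₁ ≠ e₂)
    (i : ℕ) : gain ε n u f (i + 1) 1 ≠ -1 := fun hi => by
  have hn := h.seq.three_le
  obtain ⟨ht1, hf1, ht2, hf2⟩ := localGain_eq_neg_one _ _ _ _ _ _ (gain_one (ε := ε) f (i + 1) ▸ hi)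
  -- the other new edges are not attached to the two turns as `f` is, and then gain one there
  have mid : ∀ {a}, f ≠ a → a ∈ unvisited u → gain ε n u a (i + 1) 1 = 1 := by
    intro a ha hau
    have h0 := h.gain_one_ne_zero hau (i + 1)
    have h2 := h.gain_one_ne_two hau (i + 1)
    have hno : gain ε n u a (i + 1) 1 ≠ -1 := fun hc => h.not_outer_outer ha hf hau hi hc
    rw [gain_one, ht1, ht2] at h0 h2 hno ⊢
    revert h0 h2 hno
    generalize off ε n u a (i + 1) = g
    generalize off ε n u a (i + 1 + 1) = g'
    generalize ε a (u (i + 1)) = c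
    generalize ε a (u (i + 1 + 1)) = c'
    revert g g' c c'
    decide
  have fst : ∀ {a b}, f ≠ a → f ≠ b → a ≠ b → a ∈ unvisited u → b ∈ unvisited u →
      off ε n u a (i + 1) = true := by
    intro a b ha hb hab hau hbu
    by_contra hoa
    rw [Bool.not_eq_true] at hoa
    have hadd := h.gain_add_gain_succ_ne_two ha.symm hau hf (i := i) (Or.inl hoa)
    have hadd' := h.gain_add_gain_succ_ne_two hab hau hbu (i := i) (Or.inl hoa)
    have h0 := h.gain_one_ne_zero hau i
    have h2 := h.gain_one_ne_two hau i
    rw [hi] at hadd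
    rw [mid hb hbu] at hadd'
    rw [gain_one, hoa, ht1] at hadd hadd' h0 h2
    revert hadd hadd' h0 h2
    generalize turn ε n u i = t
    generalize off ε n u a i = g
    generalize ε a (u i) = c
    generalize ε a (u (i + 1)) = c'
    revert t g c c'
    decide
  have snd : ∀ {a b}, f ≠ a → f ≠ b → a ≠ b → a ∈ unvisited u → b ∈ unvisited u →
      off ε n u a (i + 1 + 1) = false := by
    intro a b ha hb hab hau hbu
    by_contra hoa
    rw [Bool.not_eq_false] at hoa
    have hadd := h.gain_add_gain_succ_ne_two ha hf hau (i := i + 1) (Or.inr (by rw [hoa, ht2]))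
    have hadd' := h.gain_add_gain_succ_ne_two hab.symm hbu hau (i := i + 1)
      (Or.inr (by rw [hoa, ht2]))
    have h0 := h.gain_one_ne_zero hau (i + 1 + 1)
    have h2 := h.gain_one_ne_two hau (i + 1 + 1)
    rw [hi] at hadd
    rw [mid hb hbu] at hadd'
    rw [gain_one, hoa, ht2] at hadd hadd' h0 h2
    revert hadd hadd' h0 h2
    generalize turn ε n u (i + 1 + 1 + 1) = t
    generalize off ε n u a (i + 1 + 1 + 1) = g
    generalize ε a (u (i + 1 + 1)) = c
    generalize ε a (u (i + 1 + 1 + 1)) = c'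
    revert t g c c'
    decide
  -- so they are attached to the inner ends, which forces outer attachment one step earlier
  have pre : ∀ {a b}, f ≠ a → f ≠ b → a ≠ b → a ∈ unvisited u → b ∈ unvisited u →
      gain ε n u a i 1 = -1 := by
    intro a b ha hb hab hau hbu
    have hadd := h.gain_add_gain_succ_ne_two hab hau hbu (i := i)
      (Or.inr (by rw [fst hb ha hab.symm hbu hau, ht1]))
    have h0 := h.gain_one_ne_zero hau i
    have h2 := h.gain_one_ne_two hau i
    rw [mid hb hbu] at hadd
    rw [gain_one, fst ha hb hab hau hbu, ht1] at hadd h0 h2 ⊢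
    revert hadd h0 h2
    generalize turn ε n u i = t
    generalize off ε n u a i = g
    generalize ε a (u i) = c
    generalize ε a (u (i + 1)) = c'
    revert t g c c'
    decide
  have shiftGain : ∀ a, gain ε n u a (i + n - 1 + 1) 1 = gain ε n u a i 1 := fun a => by
    rw [show i + n - 1 + 1 = i + n by omega, h.seq.gain_add]
  exact h.not_outer_outer h₁₂ he₁ he₂ (i := i + n - 1)
    (by rw [shiftGain, pre h₁ h₂ h₁₂ he₁ he₂]) (by rw [shiftGain, pre h₂ h₁ h₁₂.symm he₂ he₁])

/-- If three new matching edges are available, no insertion has gain `-1`. -/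
theorem gain_one_ne_neg_one (h : IsExtremalSeq ε n u) {e₁ e₂ : ι} (hf : f ∈ unvisited u)
    (he₁ : e₁ ∈ unvisited u) (he₂ : e₂ ∈ unvisited u) (h₁ : f ≠ e₁) (h₂ : f ≠ e₂) (h₁₂ : e₁ ≠ e₂)
    (i : ℕ) : gain ε n u f i 1 ≠ -1 := by
  have hn := h.seq.three_le
  have := h.gain_one_ne_neg_one_succ hf he₁ he₂ h₁ h₂ h₁₂ (i + n - 1)
  rwa [show i + n - 1 + 1 = i + n by omega, h.seq.gain_add] at this

set_option synthInstance.maxSize 1000 in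
set_option synthInstance.maxHeartbeats 400000 in
/-- Two new matching edges cannot both be attached to a turn at the end by which it is entered. -/
theorem off_eq_true_of_off_eq_false (h : IsExtremalSeq ε n u) (hef : e ≠ f)
    (he : e ∈ unvisited u) (hf : f ∈ unvisited u) (hneg_e : ∀ i, gain ε n u e i 1 ≠ -1)
    (hneg_f : ∀ i, gain ε n u f i 1 ≠ -1) {i : ℕ} (ht : turn ε n u (i + 1) = true)
    (hoe : off ε n u e (i + 1) = false) : off ε n u f (i + 1) = true := by
  have hn := h.seq.three_le
  by_contra hof
  rw [Bool.not_eq_true] at hof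
  -- leaving the turn, both gain one
  have one_of_turn : ∀ {a : ι}, a ∈ unvisited u → (∀ j, gain ε n u a j 1 ≠ -1) → ∀ {j},
      turn ε n u j = true → off ε n u a j = false → gain ε n u a j 1 = 1 := by
    intro a ha hneg j htj hoj
    have h0 := h.gain_one_ne_zero ha j
    have h1 := hneg j
    have h2 := h.gain_one_ne_two ha j
    rw [gain_one, htj, hoj] at h0 h1 h2 ⊢
    revert h0 h1 h2
    generalize turn ε n u (j + 1) = t
    generalize off ε n u a (j + 1) = g
    generalize ε a (u j) = c
    generalize ε a (u (j + 1)) = c'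
    revert t g c c'
    decide
  have ge1 := one_of_turn he hneg_e ht hoe
  have gf1 := one_of_turn hf hneg_f ht hof
  -- entering it, both gain three
  have g0 : ∀ {a b : ι}, a ≠ b → a ∈ unvisited u → b ∈ unvisited u →
      (∀ j, gain ε n u a j 1 ≠ -1) → off ε n u a (i + 1) = false →
      gain ε n u b (i + 1) 1 = 1 → gain ε n u a i 1 = 3 := by
    intro a b hab ha hb hneg hoa hgb
    have hadd := h.gain_add_gain_succ_ne_two hab ha hb (i := i) (Or.inl hoa)
    have h0 := h.gain_one_ne_zero ha i
    have h1 := hneg i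
    have h2 := h.gain_one_ne_two ha i
    rw [hgb] at hadd
    rw [gain_one, hoa, ht] at hadd h0 h1 h2 ⊢
    revert hadd h0 h1 h2
    generalize turn ε n u i = t
    generalize off ε n u a i = g
    generalize ε a (u i) = c
    generalize ε a (u (i + 1)) = c'
    revert t g c c'
    decide
  have ge0 := g0 hef he hf hneg_e hoe gf1
  have gf0 := g0 hef.symm hf he hneg_f hof ge1
  -- the next term is attached at the end by which it is entered
  have o2 : ∀ {a : ι}, a ∈ unvisited u → off ε n u a (i + 1) = false →
      gain ε n u a i 1 = 3 → gain ε n u a (i + 1) 1 = 1 → off ε n u a (i + 2) = false := by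
    intro a ha hoa ha0 ha1
    have h2 := h.gain_ne_two ha (i := i) (d := 2) (by omega) (by omega)
    rw [gain_one, hoa, ht] at ha0
    rw [gain_one, hoa, ht, show i + 1 + 1 = i + 2 by omega] at ha1
    rw [gain_two, ht] at h2
    revert ha0 ha1 h2
    generalize turn ε n u i = t
    generalize off ε n u a i = g
    generalize turn ε n u (i + 2) = t'
    generalize off ε n u a (i + 2) = g'
    generalize ε a (u i) = c
    generalize ε a (u (i + 1)) = c1
    generalize ε a (u (i + 2)) = c2
    revert t g t' g' c c1 c2
    decide
  have oe2 := o2 he hoe ge0 ge1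
  have of2 := o2 hf hof gf0 gf1
  have n2 : gain ε n u e (i + 2) 1 ≠ 1 := fun hc =>
    h.gain_add_gain_succ_ne_two hef.symm hf he (i := i + 1) (Or.inl of2)
      (by rw [gf1, show i + 1 + 1 = i + 2 by omega, hc]; norm_num)
  have t2 : turn ε n u (i + 2) = false := by
    by_contra hc
    rw [Bool.not_eq_false] at hc
    exact n2 (one_of_turn he hneg_e hc oe2)
  -- and the one after that is no turn and attached by its unused end
  have z2 := h.gain_one_ne_zero he (i + 2)
  have w2 := h.gain_one_ne_two he (i + 2)
  have key : turn ε n u (i + 3) = false ∧ off ε n u e (i + 3) = true ∧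
      ε e (u (i + 3)) = ε e (u (i + 1)) ∧ ε e (u (i + 2)) = ε e (u i) ∧
      ε e (u (i + 1)) = !ε e (u i) := by
    rw [gain_one, hoe, ht] at ge0
    rw [gain_one, hoe, ht, show i + 1 + 1 = i + 2 by omega, oe2, t2] at ge1
    rw [gain_one, oe2, t2, show i + 2 + 1 = i + 3 by omega] at n2 z2 w2
    revert ge0 ge1 n2 z2 w2
    generalize turn ε n u i = t
    generalize off ε n u e i = g
    generalize turn ε n u (i + 3) = t'
    generalize off ε n u e (i + 3) = g'
    generalize ε e (u i) = c
    generalize ε e (u (i + 1)) = c1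
    generalize ε e (u (i + 2)) = c2
    generalize ε e (u (i + 3)) = c3
    revert t g c c1
    revert t' g' c2 c3
    decide
  obtain ⟨t3, o3, c3, c2, c1⟩ := key
  rcases (show n = 3 ∨ 4 ≤ n by omega) with rfl | hn4
  · rw [h.seq.periodic, c1] at c3
    revert c3
    cases ε e (u i) <;> decide
  -- by the insertion of `f` after the turn, `e` has no insertion of gain one further on
  have far : ∀ j, j + 2 ≤ n → gain ε n u e (i + 2 + j) 1 ≠ 1 := by
    intro j hj hc
    refine h.gain_add_gain_ne_two hef.symm hf he (i := i + 1) (j := j) (d := 1) le_rfl hj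
      (fun _ => Or.inl of2) (fun _ => Or.inr hoe) ?_
    rw [gf1, show i + 1 + 1 + j = i + 2 + j by omega, hc]
    norm_num
  have n3 := far 1 (by omega)
  have n4 := far 2 (by omega)
  have jump : gain ε n u e (i + 2) 2 ≠ 1 := by
    intro hc
    refine h.gain_add_gain_ne_two hef.symm hf he (i := i + 1) (j := 0) (d := 2) (by omega)
      (by omega) (fun _ => Or.inl of2) (by omega) ?_
    rw [gf1, show i + 1 + 1 + 0 = i + 2 by omega, hc]
    norm_num
  have w22 := h.gain_ne_two he (i := i + 2) (d := 2) (by omega) (by omega)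
  have w3 := h.gain_one_ne_two he (i + 3)
  have z3 := h.gain_one_ne_zero he (i + 3)
  have o4 : off ε n u e (i + 4) = false ∧ ε e (u (i + 4)) = !ε e (u (i + 3)) := by
    rw [show i + 2 + 1 = i + 3 by omega, gain_one, t3, o3] at n3
    rw [gain_one, t3, o3] at w3 z3
    rw [gain_two, oe2, t2] at jump w22
    simp only [show i + 2 + 1 = i + 3 by omega, t3, show i + 2 + 2 = i + 4 by omega, c2]
      at jump w22
    simp only [c3, c1, show i + 3 + 1 = i + 4 by omega] at n3 w3 z3 ⊢
    revert n3 w3 z3 jump w22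
    generalize turn ε n u (i + 4) = t
    generalize off ε n u e (i + 4) = g
    generalize ε e (u i) = c
    generalize ε e (u (i + 4)) = c4
    revert t g c c4
    decide
  obtain ⟨o4, c4⟩ := o4
  have t4 : turn ε n u (i + 4) = false := by
    by_contra hc
    rw [Bool.not_eq_false] at hc
    exact n4 (by rw [show i + 2 + 2 = i + 4 by omega]; exact one_of_turn he hneg_e hc o4)
  have w4 := h.gain_one_ne_two he (i + 4)
  have z4 := h.gain_one_ne_zero he (i + 4)
  have w33 := h.gain_ne_two he (i := i + 3) (d := 2) (by omega) (by omega)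
  rw [show i + 2 + 2 = i + 4 by omega, gain_one, o4, t4] at n4
  rw [gain_one, o4, t4] at w4 z4
  rw [gain_two, o3, t3, show i + 3 + 1 = i + 4 by omega, t4] at w33
  simp only [c4, show i + 3 + 2 = i + 5 by omega] at n4 w4 z4 w33
  revert n4 w4 z4 w33
  generalize turn ε n u (i + 5) = t
  generalize off ε n u e (i + 5) = g
  generalize ε e (u (i + 3)) = c
  generalize ε e (u (i + 5)) = c5
  revert t g c c5
  decide

end IsExtremalSeq

end CyclicSequences

/-! ### A cyclic sequence of weight `2k` -/

section CyclicSequences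

variable {ι : Type*} {ε : ι → ι → Bool} {n : ℕ} {u : ℕ → ι}

namespace IsExtremalSeq

variable {a b c : ι}

theorem off_eq_true_of_three (h : IsExtremalSeq ε n u) (ha : a ∈ unvisited u)
    (hb : b ∈ unvisited u) (hc : c ∈ unvisited u) (hab : a ≠ b) (hac : a ≠ c) (hbc : b ≠ c) {i : ℕ}
    (ht : turn ε n u i = true) (hoa : off ε n u a i = false) : off ε n u b i = true := by
  have hn := h.seq.three_le
  have := h.off_eq_true_of_off_eq_false hab ha hb (h.gain_one_ne_neg_one ha hb hc hab hac hbc)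
    (h.gain_one_ne_neg_one hb ha hc hab.symm hbc hac) (i := i + n - 1)
  rw [show i + n - 1 + 1 = i + n by omega, h.seq.turn_add, h.seq.off_add, h.seq.off_add] at this
  exact this ht hoa

/-- The mirror image of `off_eq_true_of_three`. -/
theorem off_eq_false_of_three (h : IsExtremalSeq ε n u) (ha : a ∈ unvisited u)
    (hb : b ∈ unvisited u) (hc : c ∈ unvisited u) (hab : a ≠ b) (hac : a ≠ c) (hbc : b ≠ c) {i : ℕ}
    (hi : i < n) (ht : turn ε n u i = true) (hoa : off ε n u a i = true) :
    off ε n u b i = false := by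
  have hrev := h.reverse.off_eq_true_of_three (fun j => ha _) (fun j => hb _) (fun j => hc _)
    hab hac hbc (i := n - 1 - i)
  rw [h.seq.turn_reverse (by omega), h.seq.off_reverse a (by omega),
    h.seq.off_reverse b (by omega), show n - 1 - (n - 1 - i) = i by omega, ht, hoa] at hrev
  simpa using hrev rfl rfl

/-- Of three new matching edges two are attached to a given turn by the same end, which is
impossible. -/
theorem turn_eq_false (h : IsExtremalSeq ε n u) (ha : a ∈ unvisited u)
    (hb : b ∈ unvisited u) (hc : c ∈ unvisited u) (hab : a ≠ b) (hac : a ≠ c) (hbc : b ≠ c) {i : ℕ}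
    (hi : i < n) : turn ε n u i = false := by
  by_contra ht
  rw [Bool.not_eq_false] at ht
  have h1 := h.off_eq_true_of_three ha hb hc hab hac hbc ht
  have h2 := h.off_eq_false_of_three ha hb hc hab hac hbc hi ht
  have h3 := h.off_eq_true_of_three ha hc hb hac hab hbc.symm ht
  have h4 := h.off_eq_false_of_three ha hc hb hac hab hbc.symm hi ht
  have h5 := h.off_eq_true_of_three hb hc ha hbc hab.symm hac.symm ht
  have h6 := h.off_eq_false_of_three hb hc ha hbc hab.symm hac.symm hi ht
  revert h1 h2 h3 h4 h5 h6
  generalize off ε n u a i = x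
  generalize off ε n u b i = y
  generalize off ε n u c i = z
  revert x y z
  decide

end IsExtremalSeq

theorem IsCyclicSeq.exists_turn_of_lt_weight (hw : (n : ℤ) < weight ε n u) :
    ∃ i < n, turn ε n u i = true := by
  by_contra! hno
  have : weight ε n u = n := by
    rw [weight, Finset.sum_congr rfl fun j hj => by
      rw [Bool.eq_false_of_not_eq_true (hno j (Finset.mem_range.1 hj))]]
    simp
  omega

/-- If there is a cyclic sequence of weight `2k - 2`, there is one of weight `2k`. -/
theorem IsCyclicSeq.exists_weight_add_two [Fintype ι] (h : IsCyclicSeq n u) {k : ℕ} (hk : 3 ≤ k)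
    (hcard : Fintype.card ι = 2 * k) (hw : weight ε n u = 2 * k - 2) :
    ∃ m v, IsCyclicSeq m v ∧ weight ε m v = 2 * k := by
  by_contra! hno
  obtain ⟨m, v, hv, hwv, hmax⟩ := exists_longest_of_weight (ε := ε) h
  have hext : IsExtremalSeq ε m v := ⟨hv, fun m' v' hv' hw' => hmax m' v' hv' (hw'.trans hwv),
    fun m' v' hv' => by rw [hwv, hw, sub_add_cancel]; exact hno m' v' hv'⟩
  obtain ⟨s, hs, hsc⟩ := hv.le_card_unvisited
  have hle : (m : ℤ) ≤ weight ε m v := IsCyclicSeq.le_weight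
  rcases hle.eq_or_lt with heq | hlt
  -- as many terms as the weight: there are no turns
  · obtain ⟨a, ha, b, hb, hab⟩ := Finset.one_lt_card.1 (show 1 < s.card by omega)
    obtain ⟨i, hi⟩ := hext.exists_turn (by omega) hab (hs a ha) (hs b hb)
    have : weight ε m v > m := by
      have hsum : ∑ _j ∈ Finset.range m, (1 : ℤ) < weight ε m v := by
        refine Finset.sum_lt_sum (fun j _ => by cases turn ε m v j <;> simp)
          ⟨i % m, Finset.mem_range.2 (Nat.mod_lt _ (by omega)), ?_⟩
        rw [(show Function.Periodic (turn ε m v) m from hv.turn_add).map_mod_nat, hi]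
        simp
      simpa using hsum
    omega
  -- fewer terms: there is a turn, and at least three elements are unvisited
  · obtain ⟨i, hi, ht⟩ := IsCyclicSeq.exists_turn_of_lt_weight hlt
    obtain ⟨a, b, c, ha, hb, hc, hab, hac, hbc⟩ :=
      Finset.two_lt_card_iff.1 (show 2 < s.card by omega)
    rw [hext.turn_eq_false (hs a ha) (hs b hb) (hs c hc) hab hac hbc hi] at ht
    cases ht

theorem exists_weight_eq_two_mul [Fintype ι] (ε : ι → ι → Bool) {k : ℕ} (hk : 3 ≤ k)
    (hcard : Fintype.card ι = 2 * k) :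
    ∃ n u, IsCyclicSeq n u ∧ weight ε n u = 2 * k := by
  obtain ⟨n, u, h, hle, hge⟩ := exists_weight_near ε hk hcard
  rcases (show weight ε n u = 2 * k ∨ weight ε n u = 2 * k - 2 ∨ weight ε n u = 2 * k - 1 by
    omega) with hw | hw | hw
  · exact ⟨n, u, h, hw⟩
  · exact h.exists_weight_add_two hk hcard hw
  · by_contra! hno
    have hle : (n : ℤ) ≤ weight ε n u := IsCyclicSeq.le_weight
    obtain ⟨s, hs, hsc⟩ := h.le_card_unvisited
    obtain ⟨e, he⟩ : s.Nonempty := Finset.card_pos.1 (by omega)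
    have hev := even_weight_of_natAbs_gain_ne_one (ε := ε) h (by omega) e fun i d hd hdn hg => by
      obtain ⟨u', hu', hw'⟩ := h.exists_weight_add_gain (ε := ε) (hs e he) i hd hdn
      rcases Int.natAbs_eq_iff.1 hg with hg | hg
      · exact hno _ u' hu' (by rw [hw', hg, hw]; simp)
      · obtain ⟨m, v, hv, hwv⟩ := hu'.exists_weight_add_two (ε := ε) hk hcard
          (by rw [hw', hg, hw]; push_cast; ring)
        exact hno m v hv hwv
    rw [hw] at hev
    obtain ⟨r, hr⟩ := hev
    omega

end CyclicSequences

/-! ### Lifting a cyclic sequence to a cycle of the graph -/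

theorem SimpleGraph.cycleGraph_isContained_of_list {V : Type*} {G : SimpleGraph V} {l : List V}
    (hnd : l.Nodup) (hc : l.IsChain G.Adj)
    (hlast : ∀ x ∈ l.getLast?, ∀ y ∈ l.head?, G.Adj x y) :
    (SimpleGraph.cycleGraph l.length).IsContained G := by
  have hstep : ∀ a b : Fin l.length, (b - a).val = 1 → G.Adj l[a] l[b] := by
    intro a b hab
    have ha := a.isLt
    have hb := b.isLt
    rw [Fin.sub_def] at hab
    simp only at hab
    rcases Nat.lt_or_ge (a.val + 1) l.length with hlt | hge
    · have hba : b.val = a.val + 1 := by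
        rcases Nat.lt_or_ge (l.length - a.val + b.val) l.length with h1 | h1
        · rw [Nat.mod_eq_of_lt h1] at hab
          omega
        · rw [Nat.mod_eq_sub_mod h1, Nat.mod_eq_of_lt (by omega)] at hab
          omega
      have := List.isChain_iff_getElem.1 hc a.val hlt
      simpa [hba] using this
    · have hb0 : b.val = 0 := by
        rcases Nat.lt_or_ge (l.length - a.val + b.val) l.length with h1 | h1
        · rw [Nat.mod_eq_of_lt h1] at hab
          omega
        · rw [Nat.mod_eq_sub_mod h1, Nat.mod_eq_of_lt (by omega)] at hab
          omega
      have hal : a.val = l.length - 1 := by omega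
      refine hlast _ ?_ _ ?_
      · rw [List.getLast?_eq_getElem?, ← hal]
        simp
      · rw [List.head?_eq_getElem?, ← hb0]
        simp
  refine ⟨⟨⟨fun a => l[a], ?_⟩, ?_⟩⟩
  · intro a b hab
    rcases SimpleGraph.cycleGraph_adj'.1 hab with h | h
    · exact (hstep b a h).symm
    · exact hstep a b h
  · intro a b hab
    exact Fin.ext ((List.Nodup.getElem_inj_iff hnd).1 hab)

section Lift

variable {V ι : Type*} {G : SimpleGraph V} {ε : ι → ι → Bool} {n : ℕ} {u : ℕ → ι}

/-- The vertices of the `j`-th matching edge of a cyclic sequence that the lifted cycle visits,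
where `P x b` is the end `b` of the matching edge `x`. -/
def liftBlock (ε : ι → ι → Bool) (n : ℕ) (u : ℕ → ι) (P : ι → Bool → V) (j : ℕ) : List V :=
  if turn ε n u j then
    [P (u j) (ε (u j) (u (j + n - 1))), P (u j) (ε (u j) (u (j + 1)))]
  else [P (u j) (ε (u j) (u (j + 1)))]

theorem head?_liftBlock (P : ι → Bool → V) (j : ℕ) :
    (liftBlock ε n u P j).head? = some (P (u j) (ε (u j) (u (j + n - 1)))) := by
  unfold liftBlock
  split_ifs with ht
  · rfl
  · have : ε (u j) (u (j + n - 1)) = ε (u j) (u (j + 1)) := by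
      simpa [turn, bend] using ht
    rw [this]
    rfl

theorem getLast?_liftBlock (P : ι → Bool → V) (j : ℕ) :
    (liftBlock ε n u P j).getLast? = some (P (u j) (ε (u j) (u (j + 1)))) := by
  unfold liftBlock
  split_ifs <;> rfl

theorem length_liftBlock (P : ι → Bool → V) (j : ℕ) :
    ((liftBlock ε n u P j).length : ℤ) = 1 + (turn ε n u j).toInt := by
  unfold liftBlock
  cases turn ε n u j <;> simp

theorem exists_of_mem_liftBlock {P : ι → Bool → V} {j : ℕ} {x : V}
    (hx : x ∈ liftBlock ε n u P j) : ∃ b, x = P (u j) b := by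
  unfold liftBlock at hx
  split_ifs at hx
  · simp only [List.mem_cons, List.not_mem_nil, or_false] at hx
    rcases hx with hx | hx <;> exact ⟨_, hx⟩
  · exact ⟨_, List.mem_singleton.1 hx⟩

/-- A cyclic sequence of weight `L` in a matching, any two edges of which are connected by an edge,
yields a cycle of length `L`. -/
theorem IsCyclicSeq.cycleGraph_isContained (h : IsCyclicSeq n u) {L : ℕ} (hL : weight ε n u = L)
    {P : ι → Bool → V} (hinj : ∀ x y b b', P x b = P y b' → x = y ∧ b = b')
    (hmatch : ∀ x, G.Adj (P x false) (P x true))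
    (hconn : ∀ x y, x ≠ y → G.Adj (P x (ε x y)) (P y (ε y x))) :
    (SimpleGraph.cycleGraph L).IsContained G := by
  have hn := h.three_le
  have hne : ∀ j, u j ≠ u (j + 1) := by
    intro j hj
    have h1 := h.eq_iff.1 hj
    have h2 : j ≡ j + 1 [MOD n] := h1
    have h3 := (Nat.modEq_iff_dvd' (by omega)).1 h2
    rw [Nat.add_sub_cancel_left] at h3
    have := Nat.le_of_dvd one_pos h3
    omega
  have hprev : ∀ j, u (j + 1 + n - 1) = u j := fun j => by
    rw [show j + 1 + n - 1 = j + n by omega, h.periodic]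
  have hjoin : ∀ j, ∀ x ∈ (liftBlock ε n u P j).getLast?,
      ∀ y ∈ (liftBlock ε n u P (j + 1)).head?, G.Adj x y := by
    intro j x hx y hy
    rw [getLast?_liftBlock, Option.mem_some_iff] at hx
    rw [head?_liftBlock, Option.mem_some_iff, hprev] at hy
    subst hx hy
    exact hconn _ _ (hne j)
  have hblock : ∀ j, (liftBlock ε n u P j).IsChain G.Adj := by
    intro j
    unfold liftBlock
    split_ifs with ht
    · have hne' : ε (u j) (u (j + n - 1)) ≠ ε (u j) (u (j + 1)) := by
        simpa [turn, bend] using ht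
      have hm := hmatch (u j)
      rw [List.isChain_pair]
      revert hne'
      generalize ε (u j) (u (j + n - 1)) = a
      generalize ε (u j) (u (j + 1)) = b
      cases a <;> cases b <;> simp [hm, hm.symm]
    · exact List.isChain_singleton _
  set l := (List.range n).flatMap (liftBlock ε n u P) with hl
  have hchain : ∀ m, ((List.range (m + 1)).flatMap (liftBlock ε n u P)).IsChain G.Adj ∧
      ((List.range (m + 1)).flatMap (liftBlock ε n u P)).getLast?
        = (liftBlock ε n u P m).getLast? ∧
      ((List.range (m + 1)).flatMap (liftBlock ε n u P)).head?
        = (liftBlock ε n u P 0).head? := by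
    intro m
    induction m with
    | zero => simpa using hblock 0
    | succ m ih =>
      obtain ⟨ih1, ih2, ih3⟩ := ih
      rw [List.range_succ, List.flatMap_append, List.flatMap_singleton]
      refine ⟨List.isChain_append.2 ⟨ih1, hblock _, ?_⟩, ?_, ?_⟩
      · rw [ih2]
        exact hjoin m
      · rw [List.getLast?_append, getLast?_liftBlock]
        rfl
      · rw [List.head?_append, ih3, head?_liftBlock]
        rfl
  have hlen : l.length = L := by
    have : ∀ m, (((List.range m).flatMap (liftBlock ε n u P)).length : ℤ)
        = ∑ j ∈ Finset.range m, (1 + (turn ε n u j).toInt) := by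
      intro m
      induction m with
      | zero => simp
      | succ m ih =>
        rw [List.range_succ, List.flatMap_append, List.flatMap_singleton, List.length_append,
          Nat.cast_add, ih, length_liftBlock, Finset.sum_range_succ]
    have := this n
    rw [← hl, ← weight, hL] at this
    exact_mod_cast this
  obtain ⟨m, rfl⟩ : ∃ m, n = m + 1 := ⟨n - 1, by omega⟩
  obtain ⟨hc1, hc2, hc3⟩ := hchain m
  rw [← hlen]
  refine SimpleGraph.cycleGraph_isContained_of_list ?_ hc1 ?_
  · rw [List.nodup_flatMap]
    refine ⟨?_, ?_⟩
    · intro j _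
      unfold liftBlock
      split_ifs with ht
      · have hne' : ε (u j) (u (j + (m + 1) - 1)) ≠ ε (u j) (u (j + 1)) := by
          simpa [turn, bend] using ht
        simpa using fun heq => hne' (hinj _ _ _ _ heq).2
      · exact List.nodup_singleton _
    · refine (List.nodup_range).pairwise_of_forall_ne ?_
      intro i hi j hj hij x hxi hxj
      obtain ⟨b, rfl⟩ := exists_of_mem_liftBlock hxi
      obtain ⟨b', hb⟩ := exists_of_mem_liftBlock hxj
      exact hij (h.inj i (List.mem_range.1 hi) j (List.mem_range.1 hj) (hinj _ _ _ _ hb).1)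
  · intro x hx y hy
    rw [hc2] at hx
    rw [hc3] at hy
    refine hjoin m x hx y ?_
    rw [head?_liftBlock] at hy ⊢
    have h0 : u (0 + (m + 1) - 1) = u m := by congr 1; omega
    rw [hprev, show u (m + 1) = u 0 by simpa using h.periodic 0]
    rwa [h0] at hy

end Lift

/-! ### Counting the edges around a maximum matching -/

section Matching

variable {V : Type*}

/-- A set of edges, given as unordered pairs, no two of which share an endpoint. -/
def IsEdgeMatching (M : Finset (Sym2 V)) : Prop :=
  ∀ e ∈ M, ∀ f ∈ M, ∀ x, x ∈ e → x ∈ f → e = f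

theorem IsEdgeMatching.subset {M N : Finset (Sym2 V)} (h : IsEdgeMatching M) (hN : N ⊆ M) :
    IsEdgeMatching N :=
  fun e he f hf => h e (hN he) f (hN hf)

theorem IsEdgeMatching.insert [DecidableEq V] {M : Finset (Sym2 V)} (h : IsEdgeMatching M)
    {t : Sym2 V} (ht : ∀ e ∈ M, ∀ x, x ∈ t → x ∉ e) : IsEdgeMatching (insert t M) := by
  intro e he f hf x hxe hxf
  rcases Finset.mem_insert.1 he with he' | he' <;> rcases Finset.mem_insert.1 hf with hf' | hf'
  · exact he'.trans hf'.symm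
  · exact absurd hxf (ht f hf' x (he' ▸ hxe))
  · exact absurd hxe (ht e he' x (hf' ▸ hxf))
  · exact h e he' f hf' x hxe hxf

/-- Every edge `s(a, b)` of a maximum matching can be oriented so that its tail `b` has at most one
neighbour outside of the matching: otherwise it could be exchanged for two edges. -/
theorem exists_head_tail [DecidableEq V] {T M : Finset (Sym2 V)} (hT : ∀ e ∈ T, ¬e.IsDiag)
    (hMT : M ⊆ T) (hM : IsEdgeMatching M)
    (hmax : ∀ N ⊆ T, IsEdgeMatching N → N.card ≤ M.card) {e : Sym2 V} (he : e ∈ M) :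
    ∃ a b, e = s(a, b) ∧ ∀ x y, (∀ f ∈ M, x ∉ f) → (∀ f ∈ M, y ∉ f) → s(b, x) ∈ T → s(b, y) ∈ T →
      x = y := by
  induction e with
  | h p q =>
  have hpq : p ≠ q := by simpa using hT _ (hMT he)
  by_cases hq : ∀ x y, (∀ f ∈ M, x ∉ f) → (∀ f ∈ M, y ∉ f) → s(q, x) ∈ T → s(q, y) ∈ T → x = y
  · exact ⟨p, q, rfl, hq⟩
  push Not at hq
  obtain ⟨x, y, hx, hy, hqx, hqy, hxy⟩ := hq
  refine ⟨q, p, Sym2.eq_swap, fun z _ hz _ hpz _ => ?_⟩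
  exfalso
  obtain ⟨w, hw, hqw, hwz⟩ : ∃ w, (∀ f ∈ M, w ∉ f) ∧ s(q, w) ∈ T ∧ w ≠ z := by
    by_cases hxz : x = z
    · exact ⟨y, hy, hqy, fun h => hxy (hxz.trans h.symm)⟩
    · exact ⟨x, hx, hqx, hxz⟩
  have hpM : ∀ f ∈ M, p ∈ f → f = s(p, q) := fun f hf hpf => hM f hf _ he p hpf (by simp)
  have hqM : ∀ f ∈ M, q ∈ f → f = s(p, q) := fun f hf hqf => hM f hf _ he q hqf (by simp)
  have hzq : z ≠ q := fun h => hz _ he (by simp [h])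
  have hwp : w ≠ p := fun h => hw _ he (by simp [h])
  have hN1 : IsEdgeMatching (insert s(q, w) (M.erase s(p, q))) := by
    refine (hM.subset (Finset.erase_subset _ _)).insert fun f hf v hv hvf => ?_
    rw [Finset.mem_erase] at hf
    rcases Sym2.mem_iff.1 hv with rfl | rfl
    · exact hf.1 (hqM f hf.2 hvf)
    · exact hw f hf.2 hvf
  have hN2 : IsEdgeMatching (insert s(p, z) (insert s(q, w) (M.erase s(p, q)))) := by
    refine hN1.insert fun f hf v hv hvf => ?_
    rw [Finset.mem_insert, Finset.mem_erase] at hf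
    rcases hf with rfl | hf
    · rcases Sym2.mem_iff.1 hv with rfl | rfl <;> rcases Sym2.mem_iff.1 hvf with h | h
      · exact hpq h
      · exact hwp h.symm
      · exact hzq h
      · exact hwz h.symm
    · rcases Sym2.mem_iff.1 hv with rfl | rfl
      · exact hf.1 (hpM f hf.2 hvf)
      · exact hz f hf.2 hvf
  have hsub : insert s(p, z) (insert s(q, w) (M.erase s(p, q))) ⊆ T := by
    intro f hf
    simp only [Finset.mem_insert, Finset.mem_erase] at hf
    rcases hf with rfl | rfl | hf
    exacts [hpz, hqw, hMT hf.2]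
  have hc1 : s(q, w) ∉ M.erase s(p, q) := fun h => hw _ (Finset.mem_of_mem_erase h) (by simp)
  have hc2 : s(p, z) ∉ insert s(q, w) (M.erase s(p, q)) := by
    rw [Finset.mem_insert, not_or]
    refine ⟨fun h => ?_, fun h => hz _ (Finset.mem_of_mem_erase h) (by simp)⟩
    have : z ∈ s(q, w) := h ▸ Sym2.mem_mk_right p z
    rcases Sym2.mem_iff.1 this with h | h
    exacts [hzq h, hwz h.symm]
  have := hmax _ hsub hN2
  rw [Finset.card_insert_of_notMem hc2, Finset.card_insert_of_notMem hc1,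
    Finset.card_erase_of_mem he] at this
  have := Finset.card_pos.2 ⟨_, he⟩
  omega

theorem SimpleGraph.card_le_of_maximum_matching [Fintype V] (G : SimpleGraph V)
    [DecidableRel G.Adj] {T M : Finset (Sym2 V)} (hT : ∀ e ∈ T, e ∈ G.edgeSet)
    (hMT : M ⊆ T) (hM : IsEdgeMatching M)
    (hmax : ∀ N ⊆ T, IsEdgeMatching N → N.card ≤ M.card) :
    T.card ≤ M.card * G.maxDegree + M.card * M.card := by
  classical
  have hdiag : ∀ e ∈ T, ¬e.IsDiag := fun e he => G.not_isDiag_of_mem_edgeSet (hT e he)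
  rcases T.eq_empty_or_nonempty with rfl | ⟨t₀, -⟩
  · simp
  have : Nonempty V := ⟨(Quot.out t₀).1⟩
  choose! a b hab hb using fun e (he : e ∈ M) => exists_head_tail hdiag hMT hM hmax he
  let Y : Sym2 V → Finset V := fun e => (M.image b).erase (b e) ∪
    Finset.univ.filter fun x => (∀ f ∈ M, x ∉ f) ∧ s(b e, x) ∈ T
  have hY : ∀ e ∈ M, (Y e).card ≤ M.card := by
    intro e he
    have h1 : ((M.image b).erase (b e)).card + 1 ≤ M.card := by
      rw [Finset.card_erase_add_one (Finset.mem_image_of_mem b he)]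
      exact Finset.card_image_le
    have h2 : (Finset.univ.filter fun x => (∀ f ∈ M, x ∉ f) ∧ s(b e, x) ∈ T).card ≤ 1 := by
      refine Finset.card_le_one.2 fun x hx y hy => ?_
      rw [Finset.mem_filter] at hx hy
      exact hb e he x y hx.2.1 hy.2.1 hx.2.2 hy.2.2
    exact (Finset.card_union_le _ _).trans (by omega)
  have hcover : T ⊆ (M.biUnion fun e => G.incidenceFinset (a e)) ∪
      M.biUnion fun e => (Y e).image fun y => s(b e, y) := by
    intro t ht
    rw [Finset.mem_union, Finset.mem_biUnion, Finset.mem_biUnion, or_iff_not_imp_left]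
    intro hhead
    have hhead' : ∀ e ∈ M, a e ∉ t := fun e he hat =>
      hhead ⟨e, he, by rw [G.mem_incidenceFinset]; exact ⟨hT t ht, hat⟩⟩
    have htail : ∀ x ∈ t, ∀ e ∈ M, x ∈ e → x = b e := by
      intro x hx e he hxe
      rw [hab e he] at hxe
      rcases Sym2.mem_iff.1 hxe with h | h
      · exact absurd (h ▸ hx) (hhead' e he)
      · exact h
    obtain ⟨e, he, x, hxt, hxe⟩ : ∃ e ∈ M, ∃ x, x ∈ t ∧ x ∈ e := by
      by_contra! hno
      have h1 : t ∉ M := fun h => by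
        induction t with
        | h p q => exact hno _ h p (by simp) (by simp)
      have h2 := hmax (insert t M) (Finset.insert_subset ht hMT) (hM.insert hno)
      rw [Finset.card_insert_of_notMem h1] at h2
      omega
    obtain ⟨y, rfl⟩ := Sym2.mem_iff_exists.1 hxt
    have hx := htail x hxt e he hxe
    subst hx
    refine ⟨e, he, Finset.mem_image.2 ⟨y, ?_, rfl⟩⟩
    rw [Finset.mem_union]
    by_cases hy : ∀ f ∈ M, y ∉ f
    · exact Or.inr (Finset.mem_filter.2 ⟨Finset.mem_univ _, hy, ht⟩)
    · push Not at hy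
      obtain ⟨f, hf, hyf⟩ := hy
      refine Or.inl (Finset.mem_erase.2 ⟨fun h => hdiag _ ht (by simp [h]), ?_⟩)
      rw [htail y (by simp) f hf hyf]
      exact Finset.mem_image_of_mem b hf
  calc T.card ≤ _ := Finset.card_le_card hcover
    _ ≤ _ := Finset.card_union_le _ _
    _ ≤ M.card * G.maxDegree + M.card * M.card := by
      refine add_le_add (Finset.card_biUnion_le_card_mul _ _ _ fun e _ => ?_)
        (Finset.card_biUnion_le_card_mul _ _ _ fun e he => Finset.card_image_le.trans (hY e he))
      rw [G.card_incidenceFinset_eq_degree]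
      exact G.degree_le_maxDegree _

end Matching

/-! ### Matchings in strong cliques -/

namespace SimpleGraph

variable {V : Type*} {G : SimpleGraph V}

theorem IsStrongClique.exists_adj {S : Set G.edgeSet} (hS : G.IsStrongClique S) {e f : G.edgeSet}
    (he : e ∈ S) (hf : f ∈ S) (hdisj : ∀ x, x ∈ (e : Sym2 V) → x ∉ (f : Sym2 V)) :
    ∃ x ∈ (e : Sym2 V), ∃ y ∈ (f : Sym2 V), G.Adj x y := by
  have hd := hS e he f hf
  obtain ⟨p, hp⟩ := exists_walk_of_edist_ne_top (ne_top_of_le_ne_top (by decide) hd)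
  have hlen : p.length ≤ 2 := by
    rw [← hp] at hd
    exact_mod_cast hd
  have hef : e ≠ f := by
    rintro rfl
    obtain ⟨⟨a, b⟩, h⟩ := e
    exact hdisj a (Sym2.mem_mk_left a b) (Sym2.mem_mk_left a b)
  cases p with
  | nil => exact absurd rfl hef
  | @cons _ g _ h₁ p =>
    obtain ⟨-, x, hxe, hxg⟩ := lineGraph_adj_iff_exists.1 h₁
    cases p with
    | nil => exact absurd hxg (hdisj x hxe)
    | @cons _ g' _ h₂ p =>
      cases p with
      | nil =>
        obtain ⟨-, y, hyg, hyf⟩ := lineGraph_adj_iff_exists.1 h₂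
        refine ⟨x, hxe, y, hyf, ?_⟩
        have hxy : x ≠ y := fun h => hdisj x hxe (h ▸ hyf)
        have hg : (g : Sym2 V) = s(x, y) := (Sym2.mem_and_mem_iff hxy).1 ⟨hxg, hyg⟩
        exact (mem_edgeSet G).1 (hg ▸ g.2)
      | cons _ p => simp at hlen

/-- A strong clique that contains a matching of `2k` edges makes `G` contain a cycle of
length `2k`. -/
theorem cycleGraph_isContained_of_isEdgeMatching {M : Finset (Sym2 V)} (hM : IsEdgeMatching M)
    (hG : ∀ e ∈ M, e ∈ G.edgeSet)
    (hadj : ∀ e ∈ M, ∀ f ∈ M, e ≠ f → ∃ x ∈ e, ∃ y ∈ f, G.Adj x y) {k : ℕ} (hk : 3 ≤ k)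
    (hcard : M.card = 2 * k) : (cycleGraph (2 * k)).IsContained G := by
  classical
  let P : M → Bool → V := fun e b => bif b then (Quot.out e.1).2 else (Quot.out e.1).1
  have hP : ∀ e : M, e.1 = s(P e false, P e true) := fun e => (Quot.out_eq e.1).symm
  have hPmem : ∀ (e : M) b, P e b ∈ e.1 := by
    intro e b
    rw [hP e]
    cases b <;> simp
  have hend : ∀ e : M, ∀ x ∈ e.1, ∃ b, x = P e b := by
    intro e x hx
    rw [hP e] at hx
    rcases Sym2.mem_iff.1 hx with h | h
    exacts [⟨false, h⟩, ⟨true, h⟩]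
  have hmatch : ∀ e : M, G.Adj (P e false) (P e true) := fun e => by
    have := hG e.1 e.2
    rwa [hP e, mem_edgeSet] at this
  have hconn : ∀ p : Sym2 M, ∃ q : M → Bool, ∀ x y : M, p = s(x, y) → x ≠ y →
      G.Adj (P x (q x)) (P y (q y)) := by
    intro p
    induction p with
    | h x y =>
    by_cases hxy : x = y
    · refine ⟨fun _ => true, fun a b hp hab => ?_⟩
      rcases Sym2.eq_iff.1 hp with ⟨rfl, rfl⟩ | ⟨rfl, rfl⟩
      exacts [absurd hxy hab, absurd hxy.symm hab]
    · obtain ⟨v, hv, w, hw, hvw⟩ := hadj x.1 x.2 y.1 y.2 fun h => hxy (Subtype.ext h)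
      obtain ⟨b, rfl⟩ := hend x v hv
      obtain ⟨b', rfl⟩ := hend y w hw
      refine ⟨fun z => if z = x then b else b', fun a c hp hac => ?_⟩
      rcases Sym2.eq_iff.1 hp with ⟨rfl, rfl⟩ | ⟨rfl, rfl⟩
      · simpa [Ne.symm hxy] using hvw
      · simpa [Ne.symm hxy] using hvw.symm
  choose q hq using hconn
  obtain ⟨n, u, hu, hw⟩ := exists_weight_eq_two_mul (fun x y : M => q s(x, y) x) hk (by simpa)
  refine hu.cycleGraph_isContained (L := 2 * k) (by exact_mod_cast hw) (P := P) ?_ hmatch ?_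
  · intro x y b b' hxy
    have hxy' : x = y := Subtype.ext (hM _ x.2 _ y.2 (P x b) (hPmem x b) (hxy ▸ hPmem y b'))
    subst hxy'
    refine ⟨rfl, ?_⟩
    by_contra hb
    have hne := (hmatch x).ne
    cases b <;> cases b'
    exacts [hb rfl, hne hxy, hne hxy.symm, hb rfl]
  · intro x y hxy
    rw [show s(y, x) = s(x, y) from Sym2.eq_swap]
    exact hq _ x y rfl hxy

end SimpleGraph

theorem mainTheorem3 {V : Type*} [Fintype V] (G : SimpleGraph V) [DecidableRel G.Adj]
    (k : ℕ) (hk : 3 ≤ k)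
    (hfree : (SimpleGraph.cycleGraph (2 * k)).Free G)
    (hdeg : 1 ≤ G.maxDegree) :
    (G.strongCliqueNum : ℤ) ≤
      (2 * (k : ℤ) - 1) * (G.maxDegree : ℤ) + (2 * (k : ℤ) - 1) ^ 2 := by
  classical
  have hbound : ∀ S : Finset G.edgeSet, G.IsStrongClique (S : Set G.edgeSet) →
      S.card ≤ (2 * k - 1) * G.maxDegree + (2 * k - 1) * (2 * k - 1) := by
    intro S hS
    set T : Finset (Sym2 V) := S.map (Function.Embedding.subtype _) with hTdef
    have hTG : ∀ e ∈ T, e ∈ G.edgeSet := by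
      intro e he
      obtain ⟨e', -, rfl⟩ := Finset.mem_map.1 he
      exact e'.2
    obtain ⟨M, hMmem, hMmax⟩ := Finset.exists_max_image (T.powerset.filter IsEdgeMatching)
      Finset.card ⟨∅, by simp [IsEdgeMatching]⟩
    rw [Finset.mem_filter, Finset.mem_powerset] at hMmem
    obtain ⟨hMT, hM⟩ := hMmem
    have hMcard : M.card ≤ 2 * k - 1 := by
      by_contra! hlt
      obtain ⟨N, hNM, hN⟩ := Finset.exists_subset_card_eq (show 2 * k ≤ M.card by omega)
      refine hfree (SimpleGraph.cycleGraph_isContained_of_isEdgeMatching (hM.subset hNM)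
        (fun e he => hTG e (hMT (hNM he))) (fun e he f hf hef => ?_) hk hN)
      obtain ⟨e', he', rfl⟩ := Finset.mem_map.1 (hMT (hNM he))
      obtain ⟨f', hf', rfl⟩ := Finset.mem_map.1 (hMT (hNM hf))
      exact hS.exists_adj he' hf' fun x hxe hxf => hef (hM _ (hNM he) _ (hNM hf) x hxe hxf)
    calc S.card = T.card := (Finset.card_map _).symm
      _ ≤ M.card * G.maxDegree + M.card * M.card :=
        G.card_le_of_maximum_matching hTG hMT hM fun N hN hNm =>
          hMmax N (Finset.mem_filter.2 ⟨Finset.mem_powerset.2 hN, hNm⟩)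
      _ ≤ _ := by gcongr
  have hsup : G.strongCliqueNum ≤ (2 * k - 1) * G.maxDegree + (2 * k - 1) * (2 * k - 1) := by
    refine csSup_le ⟨0, ∅, by simp [SimpleGraph.IsStrongClique], rfl⟩ ?_
    rintro _ ⟨S, hS, rfl⟩
    exact hbound S hS
  have hcast : ((2 * k - 1 : ℕ) : ℤ) = 2 * (k : ℤ) - 1 := by
    rw [Nat.cast_sub (by omega)]
    push_cast
    ring
  calc (G.strongCliqueNum : ℤ)
      ≤ (((2 * k - 1) * G.maxDegree + (2 * k - 1) * (2 * k - 1) : ℕ) : ℤ) := by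
        exact_mod_cast hsup
    _ = _ := by
        rw [Nat.cast_add, Nat.cast_mul, Nat.cast_mul, hcast]
        ring
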